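/- Let $M$ be a connected smooth manifold of dimension $n\ge 3$, $T_0M$ its tangent bundle with the zero section removed, $J=\frac{\partial}{\partial y^i}\otimes dx^i$ the tangent structure and $\mathbb{C}=y^i\frac{\partial}{\partial y^i}$ the Liouville vector field. Let $S$ be a spray on $M$, that is, a smooth vector field on $T_0M$ with $JS=\mathbb{C}$ and $[\mathbb{C},S]=S$. Put $h=\frac12(\mathrm{Id}-\mathcal{L}_SJ)$, $v=\frac12(\mathrm{Id}+\mathcal{L}_SJ)$, let $\Phi=v\circ\mathcal{L}_Sh=R^i_j\frac{\partial}{\partial y^i}\otimes dx^j$ be the Jacobi endomorphism, and let $\operatorname{Ric}=\operatorname{Tr}\Phi=R^i_i=(n-1)R$ be the Ricci curvature and $R$ the Ricci scalar. For a vector valued $1$-form $K$ write $d_K=i_K d-d\,i_K$; thus $d_Kf=df\circ K$ for functions $f$. Assume that $\operatorname{Ric}$ vanishes nowhere on $T_0M$. A Finsler function is a continuous $F:TM\to\mathbb{R}$, smooth and positive on $T_0M$, with $F(x,\lambda y)=\lambda F(x,y)$ for $\lambda\ge0$, whose metric tensor $g_{ij}=\frac12\frac{\partial^2F^2}{\partial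 y^i\partial y^j}$ has rank $n$ on $T_0M$. It metrizes $S$ if $i_S\,dd_JF^2=-dF^2$ on $T_0M$. Consider the conditions: (i) $S$ is Finsler metrizable, i.e. metrized by some Finsler function; (ii) $S$ is metrized by a Finsler function $F$ of non-vanishing scalar flag curvature: $\Phi=\kappa(F^2J-F\,d_JF\otimes\mathbb{C})$ for a smooth nowhere vanishing function $\kappa$ on $T_0M$; (iii) $S$ is metrized by a Finsler function $F$ that is an Einstein metric: $R(x,y)=\lambda(x)F^2(x,y)$ for some $\lambda\in C^\infty(M)$; (iv) $S$ is metrized by a Finsler function of non-zero constant flag curvature: as in (ii), with $\kappa$ a non-zero constant; (v) $S$ is Ricci constant: $d_hR=0$. Consider also the property (P) $S$ is isotropic, i.e. $\Phi=RJ-\alpha\otimes\mathbb{C}$ for a smooth semi-basic $1$-form $\alpha$ on $T_0M$; this $\alpha$ satisfies $d_J\alpha=0$; and condition (A) holds: $\operatorname{rank}dd_J(\operatorname{Tr}\Phi)=2n$ on $T_0M$. Then: (1) if $S$ has property (P), the five conditions (i)-(v) are equivalent; (2) conversely, if the five conditions (i)-(v) are equivalent and $S$ satisfies one of them, then $S$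 has property (P). -/

import Mathlib

open scoped Manifold ContDiff

noncomputable section

namespace SprayGeometry

/-! ### Calculus on an open set of coordinates `z = (x, y) ∈ E × E` -/

section Coordinates

variable {V : Type*} [NormedAddCommGroup V] [NormedSpace ℝ V]

/-- The exterior derivative of a `1`-form: `dθ(u, w) = (∂_u θ)(w) - (∂_w θ)(u)`. -/
def extD (θ : V → V →L[ℝ] ℝ) (z : V) : V →L[ℝ] V →L[ℝ] ℝ :=
  fderiv ℝ θ z - (fderiv ℝ θ z).flip

/-- `d_K f = i_K df = df ∘ K` for a function `f` and a vector valued `1`-form `K`. -/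
def dFun (K : V → V →L[ℝ] V) (f : V → ℝ) (z : V) : V →L[ℝ] ℝ :=
  (fderiv ℝ f z).comp (K z)

/-- `d_K θ = i_K dθ - d i_K θ` for a `1`-form `θ` and a vector valued `1`-form `K`, where
`(i_K ω)(u, w) = ω(K u, w) + ω(u, K w)` and `i_K θ = θ ∘ K`. -/
def dForm (K : V → V →L[ℝ] V) (θ : V → V →L[ℝ] ℝ) (z u w : V) : ℝ :=
  extD θ z (K z u) w + extD θ z u (K z w) - extD (fun z' => (θ z').comp (K z')) z u w

/-- The Lie derivative `(L_X A)(Y) = [X, A Y] - A [X, Y]` of a vector valued `1`-form `A`,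
written without `Y`: `L_X A = (∂_X A) + A ∘ DX - DX ∘ A`. -/
def lieD (X : V → V) (A : V → V →L[ℝ] V) (z : V) : V →L[ℝ] V :=
  fderiv ℝ A z (X z) + (A z).comp (fderiv ℝ X z) - (fderiv ℝ X z).comp (A z)

variable {E : Type*} [NormedAddCommGroup E] [NormedSpace ℝ E]

/-- The tangent structure `J = ∂/∂yⁱ ⊗ dxⁱ`. -/
def tanJ (_ : E × E) : E × E →L[ℝ] E × E :=
  (ContinuousLinearMap.inr ℝ E E).comp (ContinuousLinearMap.fst ℝ E E)

/-- The Liouville vector field `ℂ = yⁱ ∂/∂yⁱ`. -/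
def liouville (z : E × E) : E × E := (0, z.2)

/-- The horizontal projector `h = (Id - L_X J) / 2` of a spray `X`. -/
def horProj (X : E × E → E × E) (z : E × E) : E × E →L[ℝ] E × E :=
  (1 / 2 : ℝ) • (ContinuousLinearMap.id ℝ (E × E) - lieD X tanJ z)

/-- The vertical projector `v = (Id + L_X J) / 2` of a spray `X`. -/
def verProj (X : E × E → E × E) (z : E × E) : E × E →L[ℝ] E × E :=
  (1 / 2 : ℝ) • (ContinuousLinearMap.id ℝ (E × E) + lieD X tanJ z)

/-- The Jacobi endomorphism `Φ = v ∘ L_X h` of a spray `X`. -/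
def jacobi (X : E × E → E × E) (z : E × E) : E × E →L[ℝ] E × E :=
  (verProj X z).comp (lieD X (horProj X) z)

/-- The Ricci curvature `Ric = Tr Φ = Rⁱ_i`, where `Φ = Rⁱ_j ∂/∂yⁱ ⊗ dxʲ`: it is the trace of
the endomorphism `(Rⁱ_j)` of `E`. -/
def ricci (X : E × E → E × E) (z : E × E) : ℝ :=
  LinearMap.trace ℝ E
    (((ContinuousLinearMap.snd ℝ E E).comp
      ((jacobi X z).comp (ContinuousLinearMap.inl ℝ E E))).toLinearMap)

/-- The Ricci scalar `R`, given by `Ric = (n - 1) R`. -/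
def ricciScalar (X : E × E → E × E) (z : E × E) : ℝ :=
  ricci X z / ((Module.finrank ℝ E : ℝ) - 1)

/-- The metric tensor `g_{ij} = ½ ∂²(F²) / ∂yⁱ∂yʲ`. -/
def metricTensor (f : E × E → ℝ) (z : E × E) : E →L[ℝ] E →L[ℝ] ℝ :=
  fderiv ℝ (fun y => fderiv ℝ (fun y' => (1 / 2 : ℝ) * f (z.1, y') ^ 2) y) z.2

end Coordinates

/-! ### Objects on the tangent bundle and their expressions in induced coordinates

`M` is a manifold modelled on the finite-dimensional space `E`. A function, a vector field or a
`1`-form on `T₀M` is given on all of `TM`, its values on the zero section being irrelevant. -/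

section Bundle

variable {E : Type*} [NormedAddCommGroup E] [NormedSpace ℝ E]
  {M : Type*} [TopologicalSpace M] [ChartedSpace E M] [IsManifold 𝓘(ℝ, E) ∞ M]

variable (E M) in
/-- The slit tangent bundle `T₀M`, as a subset of `TM`. -/
def slit : Set (TangentBundle 𝓘(ℝ, E) M) := {p | p.2 ≠ 0}

variable (E) in
/-- The chart `(x, y)` of `TM` induced by the preferred chart of `M` at `x₀`; its domain is the
preimage in `TM` of the domain of the latter. -/
def tchart (x₀ : M) : PartialEquiv (TangentBundle 𝓘(ℝ, E) M) (E × E) :=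
  extChartAt (𝓘(ℝ, E).tangent) (⟨x₀, 0⟩ : TangentBundle 𝓘(ℝ, E) M)

variable (E) in
/-- The coordinates of the points of `T₀M` in the chart `tchart E x₀`. -/
def slitTarget (x₀ : M) : Set (E × E) := {z | z ∈ (tchart E x₀).target ∧ z.2 ≠ 0}

/-- A function on `TM` in the coordinates of `tchart E x₀`. -/
def locFun (f : TangentBundle 𝓘(ℝ, E) M → ℝ) (x₀ : M) (z : E × E) : ℝ :=
  f ((tchart E x₀).symm z)

/-- A vector field on `TM` in the coordinates of `tchart E x₀`. -/
def locVec (S : (p : TangentBundle 𝓘(ℝ, E) M) → TangentSpace (𝓘(ℝ, E).tangent) p) (x₀ : M)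
    (z : E × E) : E × E :=
  mfderiv (𝓘(ℝ, E).tangent) 𝓘(ℝ, E × E) (tchart E x₀) ((tchart E x₀).symm z)
    (S ((tchart E x₀).symm z))

/-- A `1`-form on `TM` in the coordinates of `tchart E x₀`. -/
def locForm (α : (p : TangentBundle 𝓘(ℝ, E) M) → TangentSpace (𝓘(ℝ, E).tangent) p →L[ℝ] ℝ)
    (x₀ : M) (z : E × E) : E × E →L[ℝ] ℝ :=
  (α ((tchart E x₀).symm z)).comp
    (mfderiv 𝓘(ℝ, E × E) (𝓘(ℝ, E).tangent) (tchart E x₀).symm z)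

/-- A spray: a smooth vector field `S` on `T₀M` with `J S = ℂ` and `[ℂ, S] = S`. -/
structure IsSpray (S : (p : TangentBundle 𝓘(ℝ, E) M) → TangentSpace (𝓘(ℝ, E).tangent) p) :
    Prop where
  smooth : ContMDiffOn (𝓘(ℝ, E).tangent) (𝓘(ℝ, E).tangent).tangent ∞
    (fun p => (⟨p, S p⟩ : TangentBundle (𝓘(ℝ, E).tangent) (TangentBundle 𝓘(ℝ, E) M)))
    (slit E M)
  tanJ_eq : ∀ x₀ : M, ∀ z ∈ slitTarget E x₀, tanJ z (locVec S x₀ z) = liouville z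
  lieBracket_eq : ∀ x₀ : M, ∀ z ∈ slitTarget E x₀,
    VectorField.lieBracket ℝ liouville (locVec S x₀) z = locVec S x₀ z

/-- The Ricci curvature of `S` vanishes nowhere on `T₀M`. -/
def HasNonvanishingRicci
    (S : (p : TangentBundle 𝓘(ℝ, E) M) → TangentSpace (𝓘(ℝ, E).tangent) p) : Prop :=
  ∀ x₀ : M, ∀ z ∈ slitTarget E x₀, ricci (locVec S x₀) z ≠ 0

/-- `S` is Ricci constant: `d_h R = 0` on `T₀M`. -/
def IsRicciConstant
    (S : (p : TangentBundle 𝓘(ℝ, E) M) → TangentSpace (𝓘(ℝ, E).tangent) p) : Prop :=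
  ∀ x₀ : M, ∀ z ∈ slitTarget E x₀,
    dFun (horProj (locVec S x₀)) (ricciScalar (locVec S x₀)) z = 0

/-- The `1`-form `α` is smooth on `T₀M` and semi-basic (it vanishes on the vertical vectors, which
are the values of `J`). -/
structure IsSemibasic
    (α : (p : TangentBundle 𝓘(ℝ, E) M) → TangentSpace (𝓘(ℝ, E).tangent) p →L[ℝ] ℝ) :
    Prop where
  smooth : ∀ x₀ : M, ContDiffOn ℝ ∞ (locForm α x₀) (slitTarget E x₀)
  vertical : ∀ x₀ : M, ∀ z ∈ slitTarget E x₀, ∀ u : E × E, locForm α x₀ z (tanJ z u) = 0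

/-- `S` is isotropic with the semi-basic `1`-form `α`: `Φ = R J - α ⊗ ℂ` on `T₀M`. -/
def IsIsotropicWith
    (S : (p : TangentBundle 𝓘(ℝ, E) M) → TangentSpace (𝓘(ℝ, E).tangent) p)
    (α : (p : TangentBundle 𝓘(ℝ, E) M) → TangentSpace (𝓘(ℝ, E).tangent) p →L[ℝ] ℝ) : Prop :=
  IsSemibasic α ∧ ∀ x₀ : M, ∀ z ∈ slitTarget E x₀,
    jacobi (locVec S x₀) z = ricciScalar (locVec S x₀) z • tanJ z
      - (locForm α x₀ z).smulRight (liouville z)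

/-- `d_J α = 0` on `T₀M`. -/
def IsDJClosed
    (α : (p : TangentBundle 𝓘(ℝ, E) M) → TangentSpace (𝓘(ℝ, E).tangent) p →L[ℝ] ℝ) : Prop :=
  ∀ x₀ : M, ∀ z ∈ slitTarget E x₀, ∀ u w : E × E, dForm tanJ (locForm α x₀) z u w = 0

/-- The algebraic condition (A): `rank d d_J (Tr Φ) = 2n` on `T₀M`. The rank of a `2`-form `ω` is
the rank of the linear map `u ↦ ω(u, ·)`. -/
def ConditionA
    (S : (p : TangentBundle 𝓘(ℝ, E) M) → TangentSpace (𝓘(ℝ, E).tangent) p) : Prop :=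
  ∀ x₀ : M, ∀ z ∈ slitTarget E x₀,
    Module.finrank ℝ (extD (dFun tanJ (ricci (locVec S x₀))) z).range
      = 2 * Module.finrank ℝ E

/-- A Finsler function on `M`. -/
structure IsFinsler (F : TangentBundle 𝓘(ℝ, E) M → ℝ) : Prop where
  continuous : Continuous F
  smooth : ContMDiffOn (𝓘(ℝ, E).tangent) 𝓘(ℝ, ℝ) ∞ F (slit E M)
  pos : ∀ p ∈ slit E M, 0 < F p
  homogeneous : ∀ (p : TangentBundle 𝓘(ℝ, E) M) (c : ℝ), 0 ≤ c → F ⟨p.1, c • p.2⟩ = c * F p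
  regular : ∀ x₀ : M, ∀ z ∈ slitTarget E x₀,
    Module.finrank ℝ (metricTensor (locFun F x₀) z).range = Module.finrank ℝ E

/-- `S` is the geodesic spray of `F`: `i_S d d_J F² = - d F²` on `T₀M`. -/
def IsGeodesicSpray (F : TangentBundle 𝓘(ℝ, E) M → ℝ)
    (S : (p : TangentBundle 𝓘(ℝ, E) M) → TangentSpace (𝓘(ℝ, E).tangent) p) : Prop :=
  ∀ x₀ : M, ∀ z ∈ slitTarget E x₀,
    extD (dFun tanJ (fun z' => locFun F x₀ z' ^ 2)) z (locVec S x₀ z)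
      = - fderiv ℝ (fun z' => locFun F x₀ z' ^ 2) z

/-- `S` is Finsler metrizable by the Finsler function `F`. -/
def IsMetrizableBy (F : TangentBundle 𝓘(ℝ, E) M → ℝ)
    (S : (p : TangentBundle 𝓘(ℝ, E) M) → TangentSpace (𝓘(ℝ, E).tangent) p) : Prop :=
  IsFinsler F ∧ IsGeodesicSpray F S

/-- `F`, with geodesic spray `S`, has scalar flag curvature `κ`:
`Φ = κ (F² J - F d_J F ⊗ ℂ)` on `T₀M`. -/
def HasFlagCurvature (F : TangentBundle 𝓘(ℝ, E) M → ℝ)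
    (S : (p : TangentBundle 𝓘(ℝ, E) M) → TangentSpace (𝓘(ℝ, E).tangent) p)
    (κ : TangentBundle 𝓘(ℝ, E) M → ℝ) : Prop :=
  ∀ x₀ : M, ∀ z ∈ slitTarget E x₀,
    jacobi (locVec S x₀) z = locFun κ x₀ z • (locFun F x₀ z ^ 2 • tanJ z
      - (locFun F x₀ z • dFun tanJ (locFun F x₀) z).smulRight (liouville z))

/-- `F`, with geodesic spray `S`, is an Einstein metric: `R(x, y) = lam(x) F²(x, y)` on `T₀M` for
a smooth function `lam` on `M`. -/
def IsEinstein (F : TangentBundle 𝓘(ℝ, E) M → ℝ)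
    (S : (p : TangentBundle 𝓘(ℝ, E) M) → TangentSpace (𝓘(ℝ, E).tangent) p) : Prop :=
  ∃ lam : M → ℝ, ContMDiff 𝓘(ℝ, E) 𝓘(ℝ, ℝ) ∞ lam ∧ ∀ x₀ : M, ∀ z ∈ slitTarget E x₀,
    ricciScalar (locVec S x₀) z = locFun (fun p => lam p.1) x₀ z * locFun F x₀ z ^ 2

/-- (i) `S` is Finsler metrizable. -/
def Metrizable
    (S : (p : TangentBundle 𝓘(ℝ, E) M) → TangentSpace (𝓘(ℝ, E).tangent) p) : Prop :=
  ∃ F, IsMetrizableBy F S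

/-- (ii) `S` is metrizable by a Finsler function of non-vanishing scalar flag curvature. -/
def MetrizableScalarFlag
    (S : (p : TangentBundle 𝓘(ℝ, E) M) → TangentSpace (𝓘(ℝ, E).tangent) p) : Prop :=
  ∃ F, IsMetrizableBy F S ∧ ∃ κ : TangentBundle 𝓘(ℝ, E) M → ℝ,
    ContMDiffOn (𝓘(ℝ, E).tangent) 𝓘(ℝ, ℝ) ∞ κ (slit E M) ∧ (∀ p ∈ slit E M, κ p ≠ 0) ∧
      HasFlagCurvature F S κ

/-- (iii) `S` is metrizable by an Einstein metric. -/
def MetrizableEinstein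
    (S : (p : TangentBundle 𝓘(ℝ, E) M) → TangentSpace (𝓘(ℝ, E).tangent) p) : Prop :=
  ∃ F, IsMetrizableBy F S ∧ IsEinstein F S

/-- (iv) `S` is metrizable by a Finsler function of non-zero constant flag curvature. -/
def MetrizableConstantFlag
    (S : (p : TangentBundle 𝓘(ℝ, E) M) → TangentSpace (𝓘(ℝ, E).tangent) p) : Prop :=
  ∃ F, IsMetrizableBy F S ∧ ∃ k : ℝ, k ≠ 0 ∧ HasFlagCurvature F S (fun _ => k)

/-- `S` is isotropic, satisfies the algebraic condition (A), and its semi-basic `1`-form `α`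
satisfies `d_J α = 0`. -/
def IsIsotropicADJ
    (S : (p : TangentBundle 𝓘(ℝ, E) M) → TangentSpace (𝓘(ℝ, E).tangent) p) : Prop :=
  ConditionA S ∧ ∃ α, IsIsotropicWith S α ∧ IsDJClosed α

end Bundle

end SprayGeometry

end

/-! Condition (iv) is the hub. It implies (ii) and (iii) by specialisation, each of these implies
(i) by forgetting, and it implies (v) because a geodesic spray has `d_h F² = 0`. What remains under
(P) is to reach (iv) from (i) and from (v).

From (i): put `κ = R / F²`. The Euler-Lagrange equations make `Φ` self-adjoint for the vertical
Hessian `g` of `F²` (`hessian_jacobiCoeff_symm`). Since `Φ = R J - α ⊗ ℂ`, this forces `α` to be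
proportional to `d_J F²`, and contraction with `S` gives `α = κ · ½ d_J F²`
(`form_eq_of_eulerLagrange`). The rest is Schur's lemma (`hasFDerivAt_flagCurvature`). Homogeneity
and `d_J α = 0` give `d_J R = 2α`, which compared with `R = κF²` yields `d_J κ = 0`. The Bianchi
identity in dimension at least 3 makes `α` horizontally closed (`fderiv_horLift_symm`), so `dκ ∧ d_J
F² = 0`. A further vertical derivative makes `dκ ⊗ g` symmetric in the slot of `dκ` and one slot of
`g`, which is impossible for nondegenerate `g` unless `dκ = 0`. Connectedness makes `κ` constant,
and `Ric ≠ 0` makes it non-zero.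

From (v): the metric has to be `F² = |R|`. The sign `k` of `R` is constant by connectedness, `R` is
homogeneous of degree two because `d_J R = 2α`, and condition (A) is exactly regularity of `F`. For
a function of degree two, being constant along horizontal directions already implies the
Euler-Lagrange equations (`eulerLagrange_of_horizontal`), so `d_h R = 0` makes `S` the geodesic
spray of `F`. The flag curvature is then `k = ±1`.

For the converse, any of the conditions gives (iv); then `α = (k/2) d_J F²` is `d_J`-closed, and
`Ric = (n-1) k F²` inherits (A) from the regularity of `F`.

Everything up to constancy is computed in coordinates with `X = (y, Γ)`, `N = -½ ∂Γ/∂y` and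
horizontal vectors `δ_a = (a, -N a)`. -/

noncomputable section

namespace SprayGeometry

/-! ### Differentiation on open sets: congruence, symmetry of second derivatives, product rules. -/

section LocalCalculus

variable {V W W' : Type*} [NormedAddCommGroup V] [NormedSpace ℝ V]
  [NormedAddCommGroup W] [NormedSpace ℝ W] [NormedAddCommGroup W'] [NormedSpace ℝ W']

lemma differentiableAt_of_smoothOn {U : Set V} (hU : IsOpen U) {f : V → W}
    (hf : ContDiffOn ℝ ∞ f U) {z : V} (hz : z ∈ U) : DifferentiableAt ℝ f z :=
  (hf.contDiffAt (hU.mem_nhds hz)).differentiableAt (by simp)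

lemma smoothOn_fderiv {U : Set V} (hU : IsOpen U) {f : V → W} (hf : ContDiffOn ℝ ∞ f U) :
    ContDiffOn ℝ ∞ (fderiv ℝ f) U :=
  hf.fderiv_of_isOpen hU (by simp)

lemma fderiv_congr_of_isOpen {U : Set V} (hU : IsOpen U) {f g : V → W}
    (h : ∀ z ∈ U, f z = g z) {z : V} (hz : z ∈ U) : fderiv ℝ f z = fderiv ℝ g z :=
  Filter.EventuallyEq.fderiv_eq (Filter.eventuallyEq_of_mem (hU.mem_nhds hz) h)

lemma fderiv_fderiv_symm {U : Set V} (hU : IsOpen U) {f : V → W} (hf : ContDiffOn ℝ ∞ f U)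
    {z : V} (hz : z ∈ U) (u w : V) :
    fderiv ℝ (fderiv ℝ f) z u w = fderiv ℝ (fderiv ℝ f) z w u :=
  ((hf.contDiffAt (hU.mem_nhds hz)).isSymmSndFDerivAt (by
    rw [minSmoothness_of_isRCLikeNormedField]; exact WithTop.coe_le_coe.2 le_top)).eq u w

lemma fderiv_apply_apply {A : V → W →L[ℝ] W'} {w : V → W} {z : V}
    (hA : DifferentiableAt ℝ A z) (hw : DifferentiableAt ℝ w z) (u : V) :
    fderiv ℝ (fun z => A z (w z)) z u = fderiv ℝ A z u (w z) + A z (fderiv ℝ w z u) := by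
  rw [fderiv_clm_apply hA hw]
  simp [add_comm]

lemma fderiv_apply_const {A : V → W →L[ℝ] W'} {z : V}
    (hA : DifferentiableAt ℝ A z) (w : W) (u : V) :
    fderiv ℝ (fun z => A z w) z u = fderiv ℝ A z u w := by
  rw [fderiv_apply_apply hA (differentiableAt_const w)]
  simp

end LocalCalculus

/-! ### Connection, projectors and Jacobi endomorphism of a spray in coordinates. -/

section LocalSpray

variable {E : Type*} [NormedAddCommGroup E] [NormedSpace ℝ E]

/-- A spray `X = (y, Γ)` on an open set of coordinates `(x, y)`; the last field says that `Γ` is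
positively homogeneous of degree two in `y`. -/
structure LocalSpray (X : E × E → E × E) (U : Set (E × E)) : Prop where
  isOpen : IsOpen U
  smooth : ContDiffOn ℝ ∞ X U
  fst_eq : ∀ z ∈ U, (X z).1 = z.2
  euler : ∀ z ∈ U, (fderiv ℝ X z (0, z.2)).2 = (2 : ℝ) • (X z).2

/-- The coefficients `N = -½ ∂Γ/∂y` of the nonlinear connection of the spray `X = (y, Γ)`. -/
def connCoeff (X : E × E → E × E) (z : E × E) : E →L[ℝ] E :=
  (-(1 / 2) : ℝ) • (ContinuousLinearMap.snd ℝ E E).comp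
    ((fderiv ℝ X z).comp (ContinuousLinearMap.inr ℝ E E))

/-- The horizontal lift `a ↦ (a, -N a)`. -/
def horLift (X : E × E → E × E) (z : E × E) : E →L[ℝ] E × E :=
  ContinuousLinearMap.inl ℝ E E - (ContinuousLinearMap.inr ℝ E E).comp (connCoeff X z)

/-- The components `(Rⁱ_j)` of the Jacobi endomorphism. -/
def jacobiCoeff (X : E × E → E × E) (z : E × E) : E →L[ℝ] E :=
  (ContinuousLinearMap.snd ℝ E E).comp ((jacobi X z).comp (ContinuousLinearMap.inl ℝ E E))

/-- The curvature `Ω(a, b) = [δ_a, δ_b]` of the nonlinear connection. -/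
def curvForm (X : E × E → E × E) (z : E × E) (a b : E) : E :=
  fderiv ℝ (connCoeff X) z (horLift X z b) a - fderiv ℝ (connCoeff X) z (horLift X z a) b

lemma horLift_apply (X : E × E → E × E) (z : E × E) (a : E) :
    horLift X z a = (a, - connCoeff X z a) := by
  simp [horLift]

lemma curvForm_swap (X : E × E → E × E) (z : E × E) (a b : E) :
    curvForm X z b a = - curvForm X z a b := by
  simp [curvForm]

namespace LocalSpray

variable {X : E × E → E × E} {U : Set (E × E)} (h : LocalSpray X U) {z : E × E}
include h

lemma fderiv_fst (hz : z ∈ U) (u : E × E) : (fderiv ℝ X z u).1 = u.2 := by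
  have h1 : fderiv ℝ (fun z => (X z).1) z = fderiv ℝ (fun z : E × E => z.2) z :=
    fderiv_congr_of_isOpen h.isOpen h.fst_eq hz
  have h2 := fderiv.fst (differentiableAt_of_smoothOn h.isOpen h.smooth hz)
  rw [h1] at h2
  have h3 := congrArg (fun A => A u) h2
  simpa [_root_.fderiv_snd] using h3.symm

lemma fderiv_vert (hz : z ∈ U) (b : E) :
    fderiv ℝ X z (0, b) = (b, (-2 : ℝ) • connCoeff X z b) := by
  refine Prod.ext (h.fderiv_fst hz _) ?_
  simp [connCoeff, smul_smul]

lemma smooth_connCoeff : ContDiffOn ℝ ∞ (connCoeff X) U := by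
  have := smoothOn_fderiv h.isOpen h.smooth
  unfold connCoeff
  exact ((contDiffOn_const.clm_comp (this.clm_comp contDiffOn_const))).const_smul _

lemma smooth_horLift : ContDiffOn ℝ ∞ (horLift X) U := by
  unfold horLift
  exact contDiffOn_const.sub (contDiffOn_const.clm_comp h.smooth_connCoeff)

lemma diff_connCoeff (hz : z ∈ U) : DifferentiableAt ℝ (connCoeff X) z :=
  differentiableAt_of_smoothOn h.isOpen h.smooth_connCoeff hz

lemma diff_fderiv_connCoeff (hz : z ∈ U) : DifferentiableAt ℝ (fderiv ℝ (connCoeff X)) z :=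
  differentiableAt_of_smoothOn h.isOpen (smoothOn_fderiv h.isOpen h.smooth_connCoeff) hz

lemma diff_horLift (hz : z ∈ U) : DifferentiableAt ℝ (horLift X) z :=
  differentiableAt_of_smoothOn h.isOpen h.smooth_horLift hz

lemma fderiv_horLift (hz : z ∈ U) (u : E × E) (a : E) :
    fderiv ℝ (horLift X) z u a = (0, - fderiv ℝ (connCoeff X) z u a) := by
  have h1 := h.diff_connCoeff hz
  have h2 : HasFDerivAt (fun z => horLift X z a)
      (-((ContinuousLinearMap.inr ℝ E E).comp ((fderiv ℝ (connCoeff X) z).flip a))) z := by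
    have h3 : HasFDerivAt (fun z => connCoeff X z a) ((fderiv ℝ (connCoeff X) z).flip a) z := by
      have := h1.hasFDerivAt.clm_apply (hasFDerivAt_const a z)
      simpa using this
    have h4 := ((ContinuousLinearMap.inr ℝ E E).hasFDerivAt.comp z h3).const_sub (a, (0 : E))
    refine h4.congr_of_eventuallyEq (Filter.Eventually.of_forall fun z' => ?_)
    simp [horLift]
  rw [← fderiv_apply_const (h.diff_horLift hz), h2.fderiv]
  simp

/-- `N` is itself a vertical derivative of `Γ`, so this is the symmetry of second derivatives; it
says that the Berwald connection has no torsion. -/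
lemma fderiv_connCoeff_vert_symm (hz : z ∈ U) (a b : E) :
    fderiv ℝ (connCoeff X) z (0, b) a = fderiv ℝ (connCoeff X) z (0, a) b := by
  have hd := differentiableAt_of_smoothOn h.isOpen (smoothOn_fderiv h.isOpen h.smooth) hz
  have key : ∀ a b : E, fderiv ℝ (connCoeff X) z (0, b) a
      = (-(1 / 2) : ℝ) • (fderiv ℝ (fderiv ℝ X) z (0, b) (0, a)).2 := by
    intro a b
    rw [← fderiv_apply_const (h.diff_connCoeff hz)]
    have h3 : HasFDerivAt (fun z => fderiv ℝ X z (0, a))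
        ((fderiv ℝ (fderiv ℝ X) z).flip (0, a)) z := by
      have := hd.hasFDerivAt.clm_apply (hasFDerivAt_const ((0 : E), a) z)
      simpa using this
    have h4 := (((ContinuousLinearMap.snd ℝ E E).hasFDerivAt.comp z h3).const_smul (-(1 / 2) : ℝ))
    have h5 : HasFDerivAt (fun z => connCoeff X z a) _ z :=
      h4.congr_of_eventuallyEq (Filter.Eventually.of_forall fun z' => by simp [connCoeff])
    rw [h5.fderiv]
    simp
  rw [key, key, fderiv_fderiv_symm h.isOpen h.smooth hz]

lemma connCoeff_self (hz : z ∈ U) : connCoeff X z z.2 = - (X z).2 := by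
  simp [connCoeff, h.euler z hz, smul_smul]

/-- Euler's relation gives `N y = -Γ`, so a spray is horizontal for its own connection. -/
lemma horLift_self (hz : z ∈ U) : horLift X z z.2 = X z := by
  rw [horLift_apply, h.connCoeff_self hz, neg_neg]
  exact Prod.ext (h.fst_eq z hz).symm rfl

lemma fderiv_connCoeff_self (hz : z ∈ U) (u : E × E) :
    fderiv ℝ (connCoeff X) z u z.2 + connCoeff X z u.2 = - (fderiv ℝ X z u).2 := by
  have h1 : fderiv ℝ (fun z => connCoeff X z z.2) z = fderiv ℝ (fun z => - (X z).2) z :=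
    fderiv_congr_of_isOpen h.isOpen (fun z hz => h.connCoeff_self hz) hz
  have h2 := DFunLike.congr_fun h1 u
  rw [fderiv_apply_apply (h.diff_connCoeff hz) differentiableAt_snd, fderiv_fun_neg,
    fderiv.snd (differentiableAt_of_smoothOn h.isOpen h.smooth hz)] at h2
  simpa [_root_.fderiv_snd] using h2

lemma fderiv_connCoeff_liouville (hz : z ∈ U) :
    fderiv ℝ (connCoeff X) z (0, z.2) = connCoeff X z := by
  ext a
  have h1 := h.fderiv_connCoeff_self hz (0, a)
  rw [h.fderiv_vert hz] at h1
  rw [h.fderiv_connCoeff_vert_symm hz]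
  simp only at h1
  rw [eq_sub_of_add_eq h1]
  module

lemma lieD_tanJ (hz : z ∈ U) (u : E × E) :
    lieD X tanJ z u = (- u.1, u.2 + (2 : ℝ) • connCoeff X z u.1) := by
  have h1 : fderiv ℝ (tanJ : E × E → E × E →L[ℝ] E × E) z = 0 := by
    have : (tanJ : E × E → E × E →L[ℝ] E × E) = fun _ =>
      (ContinuousLinearMap.inr ℝ E E).comp (ContinuousLinearMap.fst ℝ E E) := rfl
    rw [this, fderiv_fun_const]; rfl
  have h2 := h.fderiv_vert hz u.1
  simp only [lieD, h1]
  simp [tanJ, h.fderiv_fst hz, h2]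

lemma horProj_apply (hz : z ∈ U) (u : E × E) : horProj X z u = horLift X z u.1 := by
  simp only [horProj, _root_.smul_apply, _root_.sub_apply,
    h.lieD_tanJ hz, horLift_apply]
  exact Prod.ext (by simp; module) (by simp)

lemma verProj_apply (hz : z ∈ U) (u : E × E) :
    verProj X z u = (0, u.2 + connCoeff X z u.1) := by
  simp only [verProj, _root_.smul_apply, _root_.add_apply,
    h.lieD_tanJ hz]
  exact Prod.ext (by simp) (by simp; module)

lemma fderiv_horProj (hz : z ∈ U) (u : E × E) :
    fderiv ℝ (horProj X) z u
      = (fderiv ℝ (horLift X) z u).comp (ContinuousLinearMap.fst ℝ E E) := by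
  have e1 : fderiv ℝ (horProj X) z
      = fderiv ℝ (fun z => (horLift X z).comp (ContinuousLinearMap.fst ℝ E E)) z :=
    fderiv_congr_of_isOpen h.isOpen (fun z hz => by ext <;> simp [h.horProj_apply hz]) hz
  rw [e1, fderiv_clm_comp (h.diff_horLift hz) (differentiableAt_const _)]
  ext <;> simp

/-- The projector `v` makes the values vertical. On a vertical vector `(0, b)` the Lie derivative of
`h` reduces to `h(DX(0, b)) = δ_b`, which `v` kills; thus `Φ` is determined by its components on
`E`. -/
lemma jacobi_apply (hz : z ∈ U) (u : E × E) :
    jacobi X z u = (0, jacobiCoeff X z u.1) := by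
  have h1 : ∀ u, jacobi X z u = (0, (jacobi X z u).2) := fun u => by
    simp only [jacobi, ContinuousLinearMap.comp_apply, h.verProj_apply hz]
  have h2 : ∀ b, jacobi X z (0, b) = 0 := by
    intro b
    simp only [jacobi, ContinuousLinearMap.comp_apply, h.verProj_apply hz, lieD,
      _root_.sub_apply, _root_.add_apply, h.fderiv_horProj hz,
      h.horProj_apply hz,
      h.fderiv_vert hz, horLift_apply]
    ext <;> simp
  have h3 : u = (u.1, 0) + (0, u.2) := by simp
  rw [h3, map_add, h2, add_zero, h1]
  simp [jacobiCoeff]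

/-- Since `X = δ_y`, the bracket defining `Φ` is a bracket of horizontal fields up to terms removed
by differentiating `N y = -Γ`: `Φ` is the contraction of the curvature with the spray. -/
lemma jacobiCoeff_eq_curvForm (hz : z ∈ U) (a : E) :
    jacobiCoeff X z a = curvForm X z z.2 a := by
  have h1 := h.fderiv_connCoeff_self hz (horLift X z a)
  simp only [jacobiCoeff, jacobi, ContinuousLinearMap.comp_apply, h.verProj_apply hz, lieD,
    _root_.sub_apply, _root_.add_apply, h.fderiv_horProj hz,
      h.horProj_apply hz,
    curvForm, h.horLift_self hz, h.fderiv_horLift hz, ContinuousLinearMap.inl_apply,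
    ContinuousLinearMap.coe_fst', ContinuousLinearMap.coe_snd']
  rw [eq_sub_of_add_eq h1]
  simp only [Prod.fst_add, Prod.snd_add, Prod.fst_sub, Prod.snd_sub, map_add, map_sub,
    h.fderiv_fst hz, horLift_apply]
  simp
  abel

end LocalSpray

end LocalSpray

/-! ### Homogeneity and Bianchi identities of the curvature. -/

section Bianchi

variable {E : Type*} [NormedAddCommGroup E] [NormedSpace ℝ E]

namespace LocalSpray

variable {X : E × E → E × E} {U : Set (E × E)} (h : LocalSpray X U) {z : E × E}
include h

/-- The derivative of `z ↦ N_{δ_b} a`. -/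
lemma differentiableAt_fderiv_connCoeff_horLift (hz : z ∈ U) (a b : E) :
    DifferentiableAt ℝ (fun z => fderiv ℝ (connCoeff X) z (horLift X z b) a) z ∧
    ∀ u, fderiv ℝ (fun z => fderiv ℝ (connCoeff X) z (horLift X z b) a) z u
      = fderiv ℝ (fderiv ℝ (connCoeff X)) z u (horLift X z b) a
        - fderiv ℝ (connCoeff X) z (0, fderiv ℝ (connCoeff X) z u b) a := by
  have hd := h.diff_fderiv_connCoeff hz
  have hb : DifferentiableAt ℝ (fun z => horLift X z b) z :=
    (h.diff_horLift hz).clm_apply (differentiableAt_const b)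
  have hdb := hd.clm_apply hb
  refine ⟨hdb.clm_apply (differentiableAt_const a), fun u => ?_⟩
  rw [fderiv_apply_const hdb, fderiv_apply_apply hd hb,
    fderiv_apply_const (h.diff_horLift hz), h.fderiv_horLift hz]
  have : ((0 : E), - fderiv ℝ (connCoeff X) z u b) = -(0, fderiv ℝ (connCoeff X) z u b) := by simp
  rw [this, map_neg]
  simp [sub_eq_add_neg]

lemma fderiv_curvForm (hz : z ∈ U) (a b : E) (u : E × E) :
    fderiv ℝ (fun z => curvForm X z a b) z u
      = fderiv ℝ (fderiv ℝ (connCoeff X)) z u (horLift X z b) a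
        - fderiv ℝ (connCoeff X) z (0, fderiv ℝ (connCoeff X) z u b) a
        - (fderiv ℝ (fderiv ℝ (connCoeff X)) z u (horLift X z a) b
        - fderiv ℝ (connCoeff X) z (0, fderiv ℝ (connCoeff X) z u a) b) := by
  have h1 := h.differentiableAt_fderiv_connCoeff_horLift hz a b
  have h2 := h.differentiableAt_fderiv_connCoeff_horLift hz b a
  rw [← h1.2, ← h2.2]
  exact congrArg (fun A => A u) (fderiv_fun_sub h1.1 h2.1)

lemma fderiv_fderiv_connCoeff_vert_symm (hz : z ∈ U) (u : E × E) (a b : E) :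
    fderiv ℝ (fderiv ℝ (connCoeff X)) z u (0, b) a
      = fderiv ℝ (fderiv ℝ (connCoeff X)) z u (0, a) b := by
  have hd := h.diff_fderiv_connCoeff hz
  have key : ∀ a b : E, fderiv ℝ (fderiv ℝ (connCoeff X)) z u (0, b) a
      = fderiv ℝ (fun z => fderiv ℝ (connCoeff X) z (0, b) a) z u := fun a b => by
    rw [fderiv_apply_const (hd.clm_apply (differentiableAt_const _)), fderiv_apply_const hd]
  rw [key, key]
  exact congrArg (fun A => A u) (fderiv_congr_of_isOpen h.isOpen
    (fun z hz => h.fderiv_connCoeff_vert_symm hz a b) hz)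

lemma fderiv_fderiv_connCoeff_liouville (hz : z ∈ U) (u : E × E) :
    fderiv ℝ (fderiv ℝ (connCoeff X)) z (0, z.2) u
      = fderiv ℝ (connCoeff X) z u - fderiv ℝ (connCoeff X) z (0, u.2) := by
  have hd := h.diff_fderiv_connCoeff hz
  have hC : HasFDerivAt (fun z : E × E => ((0 : E), z.2))
      ((ContinuousLinearMap.inr ℝ E E).comp (ContinuousLinearMap.snd ℝ E E)) z :=
    ((ContinuousLinearMap.inr ℝ E E).comp (ContinuousLinearMap.snd ℝ E E)).hasFDerivAt
  have h1 := DFunLike.congr_fun (fderiv_congr_of_isOpen h.isOpen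
    (fun z hz => h.fderiv_connCoeff_liouville hz) hz) u
  rw [fderiv_apply_apply hd hC.differentiableAt, hC.fderiv] at h1
  rw [fderiv_fderiv_symm h.isOpen h.smooth_connCoeff hz]
  exact eq_sub_of_add_eq (by simpa using h1)

lemma fderiv_curvForm_liouville (hz : z ∈ U) (a b : E) :
    fderiv ℝ (fun z => curvForm X z a b) z (0, z.2) = curvForm X z a b := by
  have hn : ∀ a b : E, fderiv ℝ (connCoeff X) z (0, -b) a
      = - fderiv ℝ (connCoeff X) z (0, b) a := fun a b => by
    have : ((0 : E), -b) = -(0, b) := by simp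
    rw [this, map_neg]; rfl
  rw [h.fderiv_curvForm hz, h.fderiv_fderiv_connCoeff_liouville hz,
    h.fderiv_fderiv_connCoeff_liouville hz, h.fderiv_connCoeff_liouville hz]
  simp only [curvForm, _root_.sub_apply, horLift_apply, hn]
  abel

/-- `Ω` alternates the horizontal derivative of `N`, whose vertical derivative is symmetric. In the
cyclic sum the second derivatives of `N` therefore cancel in pairs, and so do the terms from
differentiating `δ`. -/
lemma fderiv_curvForm_vert_cyclic (hz : z ∈ U) (a b c : E) :
    fderiv ℝ (fun z => curvForm X z a b) z (0, c)
      + fderiv ℝ (fun z => curvForm X z b c) z (0, a)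
      + fderiv ℝ (fun z => curvForm X z c a) z (0, b) = 0 := by
  simp only [h.fderiv_curvForm hz]
  have hP : ∀ a b c : E, fderiv ℝ (fderiv ℝ (connCoeff X)) z (0, a) (horLift X z b) c
      = fderiv ℝ (fderiv ℝ (connCoeff X)) z (0, c) (horLift X z b) a := fun a b c => by
    rw [fderiv_fderiv_symm h.isOpen h.smooth_connCoeff hz, h.fderiv_fderiv_connCoeff_vert_symm hz,
      fderiv_fderiv_symm h.isOpen h.smooth_connCoeff hz]
  rw [hP c b a, hP c a b, hP b c a, h.fderiv_connCoeff_vert_symm hz c b,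
    h.fderiv_connCoeff_vert_symm hz c a, h.fderiv_connCoeff_vert_symm hz b a]
  abel

/-- This is the Jacobi identity for `δ_a, δ_b, δ_c`: each bracket `[δ_c, [δ_a, δ_b]]` is vertical,
with component `δ_c Ω(a, b)` plus the Berwald term `DN(0, Ω(a, b)) c`. -/
lemma fderiv_curvForm_hor_cyclic (hz : z ∈ U) (a b c : E) :
    (fderiv ℝ (fun z => curvForm X z a b) z (horLift X z c)
        + fderiv ℝ (connCoeff X) z (0, curvForm X z a b) c)
      + (fderiv ℝ (fun z => curvForm X z b c) z (horLift X z a)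
        + fderiv ℝ (connCoeff X) z (0, curvForm X z b c) a)
      + (fderiv ℝ (fun z => curvForm X z c a) z (horLift X z b)
        + fderiv ℝ (connCoeff X) z (0, curvForm X z c a) b) = 0 := by
  have hs : ∀ a b c : E, fderiv ℝ (connCoeff X) z (0, a - b) c
      = fderiv ℝ (connCoeff X) z (0, a) c - fderiv ℝ (connCoeff X) z (0, b) c := fun a b c => by
    have : ((0 : E), a - b) = (0, a) - (0, b) := by simp
    rw [this, map_sub]; rfl
  simp only [h.fderiv_curvForm hz]
  simp only [curvForm, hs]
  have hH : ∀ a b : E, fderiv ℝ (fderiv ℝ (connCoeff X)) z (horLift X z a) (horLift X z b)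
      = fderiv ℝ (fderiv ℝ (connCoeff X)) z (horLift X z b) (horLift X z a) := fun a b =>
    fderiv_fderiv_symm h.isOpen h.smooth_connCoeff hz _ _
  rw [hH c b, hH c a, hH b a]
  abel

lemma diff_jacobiCoeff_apply (hz : z ∈ U) (a : E) :
    DifferentiableAt ℝ (fun z => jacobiCoeff X z a) z ∧
    ∀ u, fderiv ℝ (fun z => jacobiCoeff X z a) z u
      = fderiv ℝ (fun z => curvForm X z z.2 a) z u :=
  have hE : (fun z => jacobiCoeff X z a) =ᶠ[nhds z] (fun z => curvForm X z z.2 a) :=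
    Filter.eventuallyEq_of_mem (h.isOpen.mem_nhds hz)
      (fun z hz => h.jacobiCoeff_eq_curvForm hz a)
  have hd : DifferentiableAt ℝ (fun z => curvForm X z z.2 a) z :=
    ((((h.diff_fderiv_connCoeff hz).clm_apply
      ((h.diff_horLift hz).clm_apply (differentiableAt_const a))).clm_apply
      differentiableAt_snd)).sub ((((h.diff_fderiv_connCoeff hz).clm_apply
      ((h.diff_horLift hz).clm_apply differentiableAt_snd)).clm_apply (differentiableAt_const a)))
  ⟨hd.congr_of_eventuallyEq hE, fun u => by rw [hE.fderiv_eq]⟩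

/-- Product rule for `Ω(y, a)`: the first term freezes the argument `y` at its value in `z`, the
second differentiates it. -/
lemma fderiv_jacobiCoeff (hz : z ∈ U) (a : E) (u : E × E) :
    fderiv ℝ (fun z => jacobiCoeff X z a) z u
      = fderiv ℝ (fun z' => curvForm X z' z.2 a) z u + curvForm X z u.2 a := by
  have hd := h.diff_fderiv_connCoeff hz
  have ha : DifferentiableAt ℝ (fun z => horLift X z a) z :=
    (h.diff_horLift hz).clm_apply (differentiableAt_const a)
  have hy : DifferentiableAt ℝ (fun z => horLift X z z.2) z :=
    (h.diff_horLift hz).clm_apply differentiableAt_snd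
  have hda := hd.clm_apply ha
  have hdy := hd.clm_apply hy
  have hn : ∀ a b : E, fderiv ℝ (connCoeff X) z (0, -b) a
      = - fderiv ℝ (connCoeff X) z (0, b) a := fun a b => by
    have : ((0 : E), -b) = -(0, b) := by simp
    rw [this, map_neg]; rfl
  rw [(h.diff_jacobiCoeff_apply hz a).2 u, h.fderiv_curvForm hz]
  have e1 : fderiv ℝ (fun z => curvForm X z z.2 a) z
      = fderiv ℝ (fun z => fderiv ℝ (connCoeff X) z (horLift X z a) z.2) z
        - fderiv ℝ (fun z => fderiv ℝ (connCoeff X) z (horLift X z z.2) a) z :=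
    fderiv_fun_sub (hda.clm_apply differentiableAt_snd) (hdy.clm_apply (differentiableAt_const a))
  rw [e1, _root_.sub_apply, fderiv_apply_apply hda differentiableAt_snd,
    fderiv_apply_const hdy, fderiv_apply_apply hd ha, fderiv_apply_apply hd hy,
    fderiv_apply_const (h.diff_horLift hz),
    fderiv_apply_apply (h.diff_horLift hz) differentiableAt_snd, h.fderiv_horLift hz,
    h.fderiv_horLift hz, map_add]
  simp only [_root_.add_apply, hn, curvForm, _root_.fderiv_snd, ContinuousLinearMap.coe_snd']
  abel

lemma fderiv_jacobiCoeff_liouville (hz : z ∈ U) (a : E) :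
    fderiv ℝ (fun z => jacobiCoeff X z a) z (0, z.2) = (2 : ℝ) • jacobiCoeff X z a := by
  rw [h.fderiv_jacobiCoeff hz, h.fderiv_curvForm_liouville hz, h.jacobiCoeff_eq_curvForm hz,
    two_smul]

/-- Recovers the whole curvature from its contraction `Φ`. Of the factor 3, two come from
differentiating the argument `y` of `Ω(y, ·)`, and one from the vertical Bianchi identity on `y, a,
b` together with homogeneity of degree one. -/
lemma fderiv_jacobiCoeff_vert_sub (hz : z ∈ U) (a b : E) :
    fderiv ℝ (fun z => jacobiCoeff X z a) z (0, b)
      - fderiv ℝ (fun z => jacobiCoeff X z b) z (0, a) = (3 : ℝ) • curvForm X z b a := by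
  have h1 := h.fderiv_curvForm_vert_cyclic hz z.2 a b
  rw [h.fderiv_curvForm_liouville hz] at h1
  have h2 : fderiv ℝ (fun z' => curvForm X z' b z.2) z (0, a)
      = - fderiv ℝ (fun z' => curvForm X z' z.2 b) z (0, a) := by
    have : (fun z' => curvForm X z' b z.2) = fun z' => - curvForm X z' z.2 b := by
      funext z'; exact curvForm_swap _ _ _ _
    rw [this, fderiv_fun_neg]; rfl
  rw [h2, curvForm_swap X z b a] at h1
  rw [h.fderiv_jacobiCoeff hz, h.fderiv_jacobiCoeff hz, curvForm_swap X z b a]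
  refine sub_eq_zero.1 (Eq.trans ?_ h1)
  module

end LocalSpray

end Bianchi

/-! ### Energies of degree two, their Euler-Lagrange equations and the resulting symmetries. -/

section Energy

variable {E : Type*} [NormedAddCommGroup E] [NormedSpace ℝ E]

/-- A smooth function on an open set of coordinates `(x, y)`, positively homogeneous of degree two
in `y`. -/
structure LocalEnergy (L : E × E → ℝ) (U : Set (E × E)) : Prop where
  isOpen : IsOpen U
  smooth : ContDiffOn ℝ ∞ L U
  euler : ∀ z ∈ U, fderiv ℝ L z (0, z.2) = 2 * L z

/-- The vertical Hessian of `L` is nondegenerate at every point of `U`. -/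
def VertNondegenerate (L : E × E → ℝ) (U : Set (E × E)) : Prop :=
  ∀ z ∈ U, ∀ a : E, (∀ b : E, fderiv ℝ (fderiv ℝ L) z (0, b) (0, a) = 0) → a = 0

/-- The Euler-Lagrange equations of `L` hold along the spray `X`. -/
def EulerLagrange (X : E × E → E × E) (L : E × E → ℝ) (U : Set (E × E)) : Prop :=
  ∀ z ∈ U, ∀ a : E, fderiv ℝ (fderiv ℝ L) z (X z) (0, a) = fderiv ℝ L z (a, 0)

lemma bilin_horLift (X : E × E → E × E) (B : E × E →L[ℝ] E × E →L[ℝ] ℝ) (z : E × E) (a : E)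
    (w : E × E) : B (horLift X z a) w = B (a, 0) w - B (0, connCoeff X z a) w := by
  have : horLift X z a = (a, 0) - (0, connCoeff X z a) := by simp [horLift_apply]
  rw [this, map_sub]; rfl

lemma tanJ_apply (z u : E × E) : tanJ z u = (0, u.1) := rfl

lemma fderiv_dFun_tanJ {f : E × E → ℝ} {z : E × E}
    (hf : DifferentiableAt ℝ (fderiv ℝ f) z) (u w : E × E) :
    fderiv ℝ (dFun tanJ f) z u w = fderiv ℝ (fderiv ℝ f) z u (0, w.1) := by
  have : dFun tanJ f = fun z : E × E => (fderiv ℝ f z).comp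
    ((ContinuousLinearMap.inr ℝ E E).comp (ContinuousLinearMap.fst ℝ E E)) := rfl
  rw [this, fderiv_clm_comp hf (differentiableAt_const _)]
  simp

lemma extD_dFun_tanJ {f : E × E → ℝ} {z : E × E}
    (hf : DifferentiableAt ℝ (fderiv ℝ f) z) (u w : E × E) :
    extD (dFun tanJ f) z u w
      = fderiv ℝ (fderiv ℝ f) z u (0, w.1) - fderiv ℝ (fderiv ℝ f) z w (0, u.1) := by
  simp [extD, fderiv_dFun_tanJ hf]

namespace LocalEnergy

variable {L : E × E → ℝ} {U : Set (E × E)} (hL : LocalEnergy L U) {z : E × E}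
include hL

lemma diff (hz : z ∈ U) : DifferentiableAt ℝ L z :=
  differentiableAt_of_smoothOn hL.isOpen hL.smooth hz

lemma diff_fderiv (hz : z ∈ U) : DifferentiableAt ℝ (fderiv ℝ L) z :=
  differentiableAt_of_smoothOn hL.isOpen (smoothOn_fderiv hL.isOpen hL.smooth) hz

lemma diff_fderiv_fderiv (hz : z ∈ U) : DifferentiableAt ℝ (fderiv ℝ (fderiv ℝ L)) z :=
  differentiableAt_of_smoothOn hL.isOpen
    (smoothOn_fderiv hL.isOpen (smoothOn_fderiv hL.isOpen hL.smooth)) hz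

lemma symm (hz : z ∈ U) (u w : E × E) :
    fderiv ℝ (fderiv ℝ L) z u w = fderiv ℝ (fderiv ℝ L) z w u :=
  fderiv_fderiv_symm hL.isOpen hL.smooth hz u w

lemma symm₃ (hz : z ∈ U) (u w w' : E × E) :
    fderiv ℝ (fderiv ℝ (fderiv ℝ L)) z u w w' = fderiv ℝ (fderiv ℝ (fderiv ℝ L)) z w u w' := by
  rw [fderiv_fderiv_symm hL.isOpen (smoothOn_fderiv hL.isOpen hL.smooth) hz u w]

lemma fderiv_fderiv_self (hz : z ∈ U) (u : E × E) :
    fderiv ℝ (fderiv ℝ L) z u (0, z.2) = 2 * fderiv ℝ L z u - fderiv ℝ L z (0, u.2) := by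
  have hC : HasFDerivAt (fun z : E × E => ((0 : E), z.2))
      ((ContinuousLinearMap.inr ℝ E E).comp (ContinuousLinearMap.snd ℝ E E)) z :=
    ((ContinuousLinearMap.inr ℝ E E).comp (ContinuousLinearMap.snd ℝ E E)).hasFDerivAt
  have h1 := DFunLike.congr_fun (fderiv_congr_of_isOpen hL.isOpen hL.euler hz) u
  rw [fderiv_apply_apply (hL.diff_fderiv hz) hC.differentiableAt, hC.fderiv,
    fderiv_const_mul (hL.diff hz)] at h1
  simp at h1
  linarith

/-- Only the `dx` components of `i_X d d_J L = -dL` carry information: Euler's relation makes the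
`dy` components automatic. -/
lemma eulerLagrange_iff {X : E × E → E × E} (hX : ∀ z ∈ U, (X z).1 = z.2) (hz : z ∈ U) :
    extD (dFun tanJ L) z (X z) = - fderiv ℝ L z ↔
      ∀ a : E, fderiv ℝ (fderiv ℝ L) z (X z) (0, a) = fderiv ℝ L z (a, 0) := by
  have key : ∀ w : E × E, extD (dFun tanJ L) z (X z) w + fderiv ℝ L z w
      = fderiv ℝ (fderiv ℝ L) z (X z) (0, w.1) - fderiv ℝ L z (w.1, 0) := by
    intro w
    rw [extD_dFun_tanJ (hL.diff_fderiv hz), hX z hz, hL.fderiv_fderiv_self hz]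
    have : w = (w.1, 0) + (0, w.2) := by simp
    have h2 : fderiv ℝ L z w = fderiv ℝ L z (w.1, 0) + fderiv ℝ L z (0, w.2) := by
      rw [← map_add, ← this]
    rw [h2]; ring
  constructor
  · intro h a
    have h1 := key (a, 0)
    rw [h] at h1
    simp only [_root_.neg_apply] at h1
    linarith
  · intro h
    refine ContinuousLinearMap.ext fun w => ?_
    have h1 := key w
    rw [h w.1] at h1
    simp only [_root_.neg_apply]
    linarith

/-- In the splitting `(x, y)` the form `d d_J L` has zero `yy` block and mixed blocks `±g`, with `g`
the vertical Hessian; hence it is nondegenerate exactly when `g` is. -/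
lemma vertNondegenerate_iff [FiniteDimensional ℝ E] (hz : z ∈ U) :
    Module.finrank ℝ (extD (dFun tanJ L) z).range = 2 * Module.finrank ℝ E ↔
      ∀ a : E, (∀ b : E, fderiv ℝ (fderiv ℝ L) z (0, b) (0, a) = 0) → a = 0 := by
  have e1 : Module.finrank ℝ (extD (dFun tanJ L) z).range = 2 * Module.finrank ℝ E ↔
      ∀ u, extD (dFun tanJ L) z u = 0 → u = 0 := by
    have h1 := LinearMap.finrank_range_add_finrank_ker (extD (dFun tanJ L) z).toLinearMap
    rw [Module.finrank_prod, ← two_mul] at h1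
    have h2 : (∀ u, extD (dFun tanJ L) z u = 0 → u = 0) ↔
        Module.finrank ℝ (LinearMap.ker (extD (dFun tanJ L) z).toLinearMap) = 0 := by
      rw [Submodule.finrank_eq_zero, LinearMap.ker_eq_bot']; rfl
    rw [h2]
    constructor <;> intro h3
    · have : Module.finrank ℝ (LinearMap.range (extD (dFun tanJ L) z).toLinearMap)
        = 2 * Module.finrank ℝ E := h3
      omega
    · omega
  have h0 : ((0 : E), (0 : E)) = 0 := rfl
  rw [e1]
  constructor
  · intro h a ha
    have := h (0, a) (ContinuousLinearMap.ext fun w => by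
      rw [extD_dFun_tanJ (hL.diff_fderiv hz), hL.symm hz (0, a), ha]
      simp [h0])
    simpa using this
  · intro h u hu
    have h1 : ∀ w, fderiv ℝ (fderiv ℝ L) z u (0, w.1) - fderiv ℝ (fderiv ℝ L) z w (0, u.1) = 0 := by
      intro w
      rw [← extD_dFun_tanJ (hL.diff_fderiv hz), hu]; rfl
    have h2 : u.1 = 0 := h u.1 fun b => by simpa [h0] using h1 (0, b)
    have h3 : u.2 = 0 := h u.2 fun b => by
      have := h1 (b, 0)
      rw [h2] at this
      have hu' : u = (0, u.2) := Prod.ext h2 rfl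
      rw [hu'] at this
      rw [hL.symm hz]
      simpa [h0] using this
    exact Prod.ext h2 h3

end LocalEnergy

namespace LocalSpray

variable {X : E × E → E × E} {U : Set (E × E)} (h : LocalSpray X U) {L : E × E → ℝ}
  (hL : LocalEnergy L U) {z : E × E}
include h hL

lemma fderiv_eulerLagrange (hEL : EulerLagrange X L U) (hz : z ∈ U) (u : E × E) (a : E) :
    fderiv ℝ (fderiv ℝ (fderiv ℝ L)) z u (X z) (0, a)
      + fderiv ℝ (fderiv ℝ L) z (fderiv ℝ X z u) (0, a)
      = fderiv ℝ (fderiv ℝ L) z u (a, 0) := by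
  have hX := differentiableAt_of_smoothOn h.isOpen h.smooth hz
  have hd := hL.diff_fderiv_fderiv hz
  have h1 := DFunLike.congr_fun (fderiv_congr_of_isOpen hL.isOpen (fun z hz => hEL z hz a) hz) u
  rw [fderiv_apply_const (hd.clm_apply hX), fderiv_apply_apply hd hX,
    fderiv_apply_const (hL.diff_fderiv hz)] at h1
  exact h1

/-- The derivative of `z ↦ D²L(δ_a, (0, b))`. -/
lemma fderiv_fderiv_fderiv_horLift (hz : z ∈ U) (u : E × E) (a b : E) :
    fderiv ℝ (fun z => fderiv ℝ (fderiv ℝ L) z (horLift X z a) (0, b)) z u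
      = fderiv ℝ (fderiv ℝ (fderiv ℝ L)) z u (horLift X z a) (0, b)
        - fderiv ℝ (fderiv ℝ L) z (0, fderiv ℝ (connCoeff X) z u a) (0, b) := by
  have hd := hL.diff_fderiv_fderiv hz
  have ha : DifferentiableAt ℝ (fun z => horLift X z a) z :=
    (h.diff_horLift hz).clm_apply (differentiableAt_const a)
  rw [fderiv_apply_const (hd.clm_apply ha), fderiv_apply_apply hd ha,
    fderiv_apply_const (h.diff_horLift hz), h.fderiv_horLift hz]
  have : ((0 : E), - fderiv ℝ (connCoeff X) z u a) = -(0, fderiv ℝ (connCoeff X) z u a) := by simp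
  rw [this, map_neg]
  simp [sub_eq_add_neg]

/-- Take the vertical derivative of the Euler-Lagrange equations and alternate: the third derivative
of `L` drops out. Geometrically, the horizontal distribution is isotropic for `d d_J L`. -/
lemma hessian_horLift_symm (hEL : EulerLagrange X L U) (hz : z ∈ U) (a b : E) :
    fderiv ℝ (fderiv ℝ L) z (horLift X z a) (0, b)
      = fderiv ℝ (fderiv ℝ L) z (horLift X z b) (0, a) := by
  have key : ∀ a b : E, fderiv ℝ (fderiv ℝ (fderiv ℝ L)) z (X z) (0, b) (0, a)
      + fderiv ℝ (fderiv ℝ L) z (b, 0) (0, a)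
      - 2 * fderiv ℝ (fderiv ℝ L) z (0, connCoeff X z b) (0, a)
      = fderiv ℝ (fderiv ℝ L) z (a, 0) (0, b) := by
    intro a b
    have h1 := h.fderiv_eulerLagrange hL hEL hz (0, b) a
    have h2 : fderiv ℝ X z (0, b) = (b, 0) - (2 : ℝ) • (0, connCoeff X z b) := by
      rw [h.fderiv_vert hz]; simp
    rw [hL.symm₃ hz, h2, map_sub, map_smul, hL.symm hz (0, b)] at h1
    simpa [add_sub_assoc] using h1
  have h1 := key a b
  have h2 := key b a
  have h3 : fderiv ℝ (fderiv ℝ (fderiv ℝ L)) z (X z) (0, b) (0, a)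
      = fderiv ℝ (fderiv ℝ (fderiv ℝ L)) z (X z) (0, a) (0, b) := by
    have e : ∀ a b : E, fderiv ℝ (fderiv ℝ (fderiv ℝ L)) z (X z) (0, b) (0, a)
        = fderiv ℝ (fun z => fderiv ℝ (fderiv ℝ L) z (0, b) (0, a)) z (X z) := fun a b => by
      rw [fderiv_apply_const ((hL.diff_fderiv_fderiv hz).clm_apply (differentiableAt_const _)),
        fderiv_apply_const (hL.diff_fderiv_fderiv hz)]
    rw [e, e]
    exact DFunLike.congr_fun (fderiv_congr_of_isOpen hL.isOpen
      (fun z hz => hL.symm hz _ _) hz) _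
  rw [bilin_horLift, bilin_horLift]
  linarith

/-- The symmetry above with `b = y`: one side is then the Euler-Lagrange expression since `δ_y = X`,
the other is evaluated by Euler's relation. -/
lemma fderiv_energy_horLift (hEL : EulerLagrange X L U) (hz : z ∈ U) (a : E) :
    fderiv ℝ L z (horLift X z a) = 0 := by
  have h1 := h.hessian_horLift_symm hL hEL hz a z.2
  rw [h.horLift_self hz, hEL z hz, hL.fderiv_fderiv_self hz] at h1
  have h2 : horLift X z a = (a, 0) + (0, (horLift X z a).2) := by simp [horLift_apply]
  have h3 := congrArg (fderiv ℝ L z) h2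
  rw [map_add] at h3
  linarith

/-- Differentiate the symmetric form `D²L(δ_a, (0, b))` along `X`. Apart from `g(Φ a, b)`, the
resulting terms are jointly symmetric in `a, b`, so `Φ` must be self-adjoint for `g`. -/
lemma hessian_jacobiCoeff_symm (hEL : EulerLagrange X L U) (hz : z ∈ U) (a b : E) :
    fderiv ℝ (fderiv ℝ L) z (0, jacobiCoeff X z a) (0, b)
      = fderiv ℝ (fderiv ℝ L) z (0, jacobiCoeff X z b) (0, a) := by
  have hsym : ∀ {z}, z ∈ U → _ := fun {z} hz => h.hessian_horLift_symm hL hEL (z := z) hz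
  have key : ∀ a b : E, fderiv ℝ (fun z => fderiv ℝ (fderiv ℝ L) z (horLift X z a) (0, b)) z (X z)
      = fderiv ℝ (fderiv ℝ L) z (horLift X z a) (horLift X z b)
        + fderiv ℝ (fderiv ℝ L) z (horLift X z a) (0, connCoeff X z b)
        + fderiv ℝ (fderiv ℝ L) z (horLift X z (connCoeff X z a)) (0, b)
        + fderiv ℝ (fderiv ℝ L) z (0, jacobiCoeff X z a) (0, b) := by
    intro a b
    have h1 := h.fderiv_eulerLagrange hL hEL hz (horLift X z a) b
    rw [h.fderiv_fderiv_fderiv_horLift hL hz, hL.symm₃ hz]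
    have h2 : horLift X z b = (b, 0) - (0, connCoeff X z b) := by simp [horLift_apply]
    -- Differentiating `N y = -Γ` along `δ_a` gives the vertical part of `DX(δ_a)`; the curvature
    -- enters through `Φ a = Ω(y, a)`.
    have h3 : fderiv ℝ X z (horLift X z a) = - horLift X z (connCoeff X z a)
        - (0, jacobiCoeff X z a) - (0, fderiv ℝ (connCoeff X) z (X z) a) := by
      refine Prod.ext (by simp [h.fderiv_fst hz, horLift_apply]) ?_
      have h4 := h.fderiv_connCoeff_self hz (horLift X z a)
      rw [h.jacobiCoeff_eq_curvForm hz, curvForm, h.horLift_self hz, ← neg_eq_iff_eq_neg.2 h4]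
      simp [horLift_apply]
      abel
    rw [h3, map_sub, map_sub, map_neg] at h1
    rw [h2, map_sub, ← h1]
    simp only [_root_.sub_apply, _root_.neg_apply]
    ring
  have h1 := key a b
  have h2 := key b a
  have h3 : fderiv ℝ (fun z => fderiv ℝ (fderiv ℝ L) z (horLift X z a) (0, b)) z (X z)
      = fderiv ℝ (fun z => fderiv ℝ (fderiv ℝ L) z (horLift X z b) (0, a)) z (X z) :=
    DFunLike.congr_fun (fderiv_congr_of_isOpen hL.isOpen (fun z hz => hsym hz a b) hz) _
  rw [h1, h2, hL.symm hz (horLift X z a) (horLift X z b), hsym hz a (connCoeff X z b),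
    hsym hz (connCoeff X z a) b] at h3
  linarith

/-- A vertical derivative of `DL(δ_a) = 0` gives `D²L(δ_a, (0, b)) = DL(0, DN(0, b) a)`, symmetric
because `DN` is. Setting `b = y` and using Euler's relation yields the Euler-Lagrange equations,
without any nondegeneracy of `L`. -/
lemma eulerLagrange_of_horizontal
    (hH : ∀ z ∈ U, ∀ a : E, fderiv ℝ L z (horLift X z a) = 0) : EulerLagrange X L U := by
  have hT : ∀ z ∈ U, ∀ a b : E, fderiv ℝ (fderiv ℝ L) z (horLift X z a) (0, b)
      = fderiv ℝ L z (0, fderiv ℝ (connCoeff X) z (0, b) a) := by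
    intro z hz a b
    have h1 := DFunLike.congr_fun (fderiv_congr_of_isOpen hL.isOpen
      (fun z hz => hH z hz a) hz) (0, b)
    have ha : DifferentiableAt ℝ (fun z => horLift X z a) z :=
      (h.diff_horLift hz).clm_apply (differentiableAt_const a)
    rw [fderiv_apply_apply (hL.diff_fderiv hz) ha, fderiv_apply_const (h.diff_horLift hz),
      h.fderiv_horLift hz, hL.symm hz] at h1
    have : ((0 : E), - fderiv ℝ (connCoeff X) z (0, b) a)
      = -(0, fderiv ℝ (connCoeff X) z (0, b) a) := by simp
    rw [this, map_neg] at h1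
    simp at h1
    linarith
  intro z hz a
  have h1 : fderiv ℝ (fderiv ℝ L) z (X z) (0, a)
      = fderiv ℝ (fderiv ℝ L) z (horLift X z a) (0, z.2) := by
    rw [← h.horLift_self hz, hT z hz, hT z hz, h.fderiv_connCoeff_vert_symm hz]
  have h2 : horLift X z a = (a, 0) + (0, (horLift X z a).2) := by simp [horLift_apply]
  have h3 := congrArg (fderiv ℝ L z) h2
  rw [map_add] at h3
  rw [h1, hL.fderiv_fderiv_self hz]
  have := hH z hz a
  linarith

end LocalSpray

end Energy

/-! ### Isotropic sprays and Schur's lemma. -/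

section Isotropic

variable {E : Type*} [NormedAddCommGroup E] [NormedSpace ℝ E]

/-- The spray `X` is isotropic on `U`, with a semi-basic `1`-form `A` such that `d_J A = 0`. -/
structure LocalIsotropic (X : E × E → E × E) (U : Set (E × E)) (A : E × E → E →L[ℝ] ℝ) :
    Prop where
  smooth : ContDiffOn ℝ ∞ A U
  ne_zero : ∀ z ∈ U, z.2 ≠ 0
  jacobi_eq : ∀ z ∈ U, ∀ a : E, jacobiCoeff X z a = A z z.2 • a - A z a • z.2
  symm : ∀ z ∈ U, ∀ a b : E, fderiv ℝ A z (0, a) b = fderiv ℝ A z (0, b) a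

lemma exists_notMem_of_finrank_lt {K : Submodule ℝ E} [FiniteDimensional ℝ E]
    (h : Module.finrank ℝ K < Module.finrank ℝ E) : ∃ b : E, b ∉ K := by
  by_contra! hc
  have : K = ⊤ := Submodule.eq_top_iff'.2 hc
  rw [this, finrank_top] at h
  exact lt_irrefl _ h

lemma exists_notMem_span_singleton [FiniteDimensional ℝ E] (hn : 2 ≤ Module.finrank ℝ E) (y : E) :
    ∃ b : E, b ∉ Submodule.span ℝ {y} :=
  exists_notMem_of_finrank_lt (lt_of_le_of_lt (by simpa using finrank_span_le_card (R := ℝ) ({y} : Set E)) hn)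

lemma exists_notMem_span_pair [FiniteDimensional ℝ E] (hn : 3 ≤ Module.finrank ℝ E) (a c : E) :
    ∃ b : E, b ∉ Submodule.span ℝ {a, c} := by
  classical
  refine exists_notMem_of_finrank_lt (lt_of_le_of_lt ?_ hn)
  have := finrank_span_finset_le_card (R := ℝ) ({a, c} : Finset E)
  rw [Finset.coe_pair] at this
  exact this.trans Finset.card_le_two

lemma eq_zero_of_smul_mem {K : Submodule ℝ E} {b : E} (hb : b ∉ K) {c : ℝ} (h : c • b ∈ K) :
    c = 0 := by
  by_contra hc
  exact hb ((K.smul_mem_iff hc).1 h)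

namespace LocalIsotropic

variable [FiniteDimensional ℝ E] {X : E × E → E × E} {U : Set (E × E)}
  {A : E × E → E →L[ℝ] ℝ} (hA : LocalIsotropic X U A) (h : LocalSpray X U) {z : E × E}
include hA h

omit [FiniteDimensional ℝ E] in
lemma diff (hz : z ∈ U) : DifferentiableAt ℝ A z :=
  differentiableAt_of_smoothOn h.isOpen hA.smooth hz

omit [FiniteDimensional ℝ E] in
lemma diff_scalar (hz : z ∈ U) : DifferentiableAt ℝ (fun z => A z z.2) z :=
  (hA.diff h hz).clm_apply differentiableAt_snd

omit [FiniteDimensional ℝ E] in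
lemma fderiv_scalar (hz : z ∈ U) (u : E × E) :
    fderiv ℝ (fun z => A z z.2) z u = fderiv ℝ A z u z.2 + A z u.2 := by
  rw [fderiv_apply_apply (hA.diff h hz) differentiableAt_snd]
  simp [_root_.fderiv_snd]

omit [FiniteDimensional ℝ E] in
lemma fderiv_jacobiCoeff (hz : z ∈ U) (u : E × E) (a : E) :
    fderiv ℝ (fun z => jacobiCoeff X z a) z u
      = (fderiv ℝ A z u z.2 + A z u.2) • a - (fderiv ℝ A z u a • z.2 + A z a • u.2) := by
  have h1 := fderiv_congr_of_isOpen h.isOpen (fun z hz => hA.jacobi_eq z hz a) hz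
  have hd := hA.diff h hz
  have hda : DifferentiableAt ℝ (fun z => A z a) z := hd.clm_apply (differentiableAt_const a)
  rw [h1, fderiv_fun_sub ((hA.diff_scalar h hz).smul_const a) (hda.fun_smul differentiableAt_snd),
    _root_.sub_apply, fderiv_smul_const (hA.diff_scalar h hz), fderiv_fun_smul hda
    differentiableAt_snd]
  simp [hA.fderiv_scalar h hz, fderiv_apply_const hd, _root_.fderiv_snd, add_comm]

/-- Homogeneity of `A` is inherited from that of `Φ`. Euler's relation for `Φ` equates a multiple of
`a` with a multiple of `y`; a vector `a` off the line of `y` kills the first coefficient, and `y ≠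
0` kills the second. -/
lemma fderiv_liouville (hn : 2 ≤ Module.finrank ℝ E) (hz : z ∈ U) (a : E) :
    fderiv ℝ A z (0, z.2) a = A z a := by
  obtain ⟨b, hb⟩ := exists_notMem_span_singleton hn z.2
  have key : ∀ a, (fderiv ℝ A z (0, z.2) z.2 - A z z.2) • a
      = (fderiv ℝ A z (0, z.2) a - A z a) • z.2 := by
    intro a
    have h1 := h.fderiv_jacobiCoeff_liouville hz a
    rw [hA.fderiv_jacobiCoeff h hz, hA.jacobi_eq z hz] at h1
    refine sub_eq_zero.1 (Eq.trans ?_ (sub_eq_zero.2 h1))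
    module
  have h2 : fderiv ℝ A z (0, z.2) z.2 - A z z.2 = 0 := by
    refine eq_zero_of_smul_mem hb ?_
    rw [key]
    exact Submodule.smul_mem _ _ (Submodule.mem_span_singleton_self _)
  have h3 := key a
  rw [h2, zero_smul, eq_comm, smul_eq_zero] at h3
  exact sub_eq_zero.1 (h3.resolve_right (hA.ne_zero z hz))

lemma fderiv_scalar_vert (hn : 2 ≤ Module.finrank ℝ E) (hz : z ∈ U) (b : E) :
    fderiv ℝ (fun z => A z z.2) z (0, b) = 2 * A z b := by
  rw [hA.fderiv_scalar h hz, hA.symm z hz, hA.fderiv_liouville h hn hz, two_mul]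

lemma fderiv_scalar_liouville (hn : 2 ≤ Module.finrank ℝ E) (hz : z ∈ U) :
    fderiv ℝ (fun z => A z z.2) z (0, z.2) = 2 * A z z.2 :=
  hA.fderiv_scalar_vert h hn hz z.2

/-- Insert `Φ a = A(y) a - A(a) y` into the identity expressing `3Ω` by vertical derivatives of `Φ`;
closedness and homogeneity of `A` remove every derivative. -/
lemma curvForm_eq (hn : 2 ≤ Module.finrank ℝ E) (hz : z ∈ U) (a b : E) :
    curvForm X z a b = A z a • b - A z b • a := by
  have h1 := h.fderiv_jacobiCoeff_vert_sub hz b a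
  simp only [hA.fderiv_jacobiCoeff h hz] at h1
  rw [hA.symm z hz a z.2, hA.symm z hz b z.2, hA.fderiv_liouville h hn hz,
    hA.fderiv_liouville h hn hz, hA.symm z hz a b] at h1
  have h2 : curvForm X z a b = (1 / 3 : ℝ) • ((3 : ℝ) • curvForm X z a b) := by module
  rw [h2, ← h1]
  module

lemma fderiv_curvForm (hn : 2 ≤ Module.finrank ℝ E) (hz : z ∈ U) (a b : E) (u : E × E) :
    fderiv ℝ (fun z => curvForm X z a b) z u = fderiv ℝ A z u a • b - fderiv ℝ A z u b • a := by
  have h1 := fderiv_congr_of_isOpen h.isOpen (fun z hz => hA.curvForm_eq h hn hz a b) hz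
  have hd := hA.diff h hz
  have hda : ∀ a, DifferentiableAt ℝ (fun z => A z a) z :=
    fun a => hd.clm_apply (differentiableAt_const a)
  rw [h1, fderiv_fun_sub ((hda a).smul_const b) ((hda b).smul_const a), _root_.sub_apply,
    fderiv_smul_const (hda a), fderiv_smul_const (hda b)]
  simp [fderiv_apply_const hd]

/-- The form `A` is closed in the horizontal directions: a consequence of the Bianchi identity. -/
lemma fderiv_horLift_symm (hn : 3 ≤ Module.finrank ℝ E) (hz : z ∈ U) (a c : E) :
    fderiv ℝ A z (horLift X z c) a = fderiv ℝ A z (horLift X z a) c := by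
  have hn' : 2 ≤ Module.finrank ℝ E := by omega
  obtain ⟨b, hb⟩ := exists_notMem_span_pair hn a c
  have h1 := h.fderiv_curvForm_hor_cyclic hz a b c
  simp only [hA.fderiv_curvForm h hn' hz, hA.curvForm_eq h hn' hz] at h1
  have hs : ∀ (s t : ℝ) (a b c : E), fderiv ℝ (connCoeff X) z (0, s • a - t • b) c
      = s • fderiv ℝ (connCoeff X) z (0, a) c - t • fderiv ℝ (connCoeff X) z (0, b) c := by
    intro s t a b c
    have : ((0 : E), s • a - t • b) = s • (0, a) - t • (0, b) := by simp
    rw [this, map_sub, map_smul, map_smul]; rfl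
  simp only [hs] at h1
  rw [h.fderiv_connCoeff_vert_symm hz c b, h.fderiv_connCoeff_vert_symm hz c a,
    h.fderiv_connCoeff_vert_symm hz b a] at h1
  -- With `Ω = A ∧ Id` the Berwald terms cancel and the Bianchi identity is a linear relation
  -- between `a, b, c`. The wanted difference is the coefficient of `b`, which vanishes as `b` lies
  -- outside the span of `a` and `c`; the witnesses are the other two coefficients, negated.
  rw [← sub_eq_zero]
  refine eq_zero_of_smul_mem hb (Submodule.mem_span_pair.2
    ⟨- (fderiv ℝ A z (horLift X z b) c - fderiv ℝ A z (horLift X z c) b),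
      - (fderiv ℝ A z (horLift X z a) b - fderiv ℝ A z (horLift X z b) a), ?_⟩)
  rw [← sub_eq_zero, ← neg_eq_zero]
  refine Eq.trans ?_ h1
  module

variable {L : E × E → ℝ} (hL : LocalEnergy L U)
include hL

-- Self-adjointness of `Φ`: its multiple of the identity contributes nothing, and `g(y, ·)` is `d_J
-- L` by homogeneity, so `A ∧ d_J L = 0`. Evaluating on `y` fixes the factor of proportionality.
omit [FiniteDimensional ℝ E] in
lemma form_eq_of_eulerLagrange (hEL : EulerLagrange X L U) (hL0 : ∀ z ∈ U, L z ≠ 0)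
    (hz : z ∈ U) (a : E) :
    A z a = A z z.2 / L z * (1 / 2 * fderiv ℝ L z (0, a)) := by
  have hy : ∀ b : E, fderiv ℝ (fderiv ℝ L) z (0, z.2) (0, b) = fderiv ℝ L z (0, b) := by
    intro b
    rw [hL.symm hz, hL.fderiv_fderiv_self hz]; ring
  have key : ∀ a b : E, A z a * fderiv ℝ L z (0, b) = A z b * fderiv ℝ L z (0, a) := by
    intro a b
    have h1 := h.hessian_jacobiCoeff_symm hL hEL hz a b
    have h2 : ∀ a : E, ((0 : E), jacobiCoeff X z a) = A z z.2 • (0, a) - A z a • (0, z.2) := by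
      intro a
      rw [hA.jacobi_eq z hz]; simp
    rw [h2, h2, map_sub, map_sub, map_smul, map_smul, map_smul, map_smul] at h1
    simp only [_root_.sub_apply, _root_.smul_apply, smul_eq_mul, hy] at h1
    rw [hL.symm hz (0, b) (0, a)] at h1
    linarith
  have h3 := key a z.2
  rw [hL.euler z hz] at h3
  have := hL0 z hz
  field_simp
  linarith

/-- Schur's lemma: the flag curvature of an isotropic metric with `d_J A = 0` is locally constant. -/
lemma hasFDerivAt_flagCurvature (hEL : EulerLagrange X L U) (hL0 : ∀ z ∈ U, L z ≠ 0)
    (hG : VertNondegenerate L U) (hn : 3 ≤ Module.finrank ℝ E) (hz : z ∈ U) :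
    HasFDerivAt (fun z => A z z.2 / L z) (0 : E × E →L[ℝ] ℝ) z := by
  have hn' : 2 ≤ Module.finrank ℝ E := by omega
  set κ : E × E → ℝ := fun z => A z z.2 / L z with hκ
  have hsm : ContDiffOn ℝ ∞ κ U := (hA.smooth.clm_apply contDiffOn_snd).div hL.smooth hL0
  have hdκ : ∀ z ∈ U, DifferentiableAt ℝ κ z := fun z hz =>
    differentiableAt_of_smoothOn h.isOpen hsm hz
  have hdκ' : ∀ z ∈ U, DifferentiableAt ℝ (fderiv ℝ κ) z := fun z hz =>
    differentiableAt_of_smoothOn h.isOpen (smoothOn_fderiv h.isOpen hsm) hz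
  have hAκ : ∀ z ∈ U, ∀ a, A z a = κ z * (1 / 2 * fderiv ℝ L z (0, a)) := fun z hz a =>
    hA.form_eq_of_eulerLagrange h hL hEL hL0 hz a
  -- The vertical derivative of `A(y) = κ L` is `2A(b)` by homogeneity, and `κ DL(0, b)` already
  -- accounts for all of it.
  have hv : ∀ z ∈ U, ∀ b : E, fderiv ℝ κ z (0, b) = 0 := by
    intro z hz b
    have h1 : fderiv ℝ (fun z => A z z.2) z = fderiv ℝ (fun z => κ z * L z) z :=
      fderiv_congr_of_isOpen h.isOpen (fun z hz => (div_mul_cancel₀ _ (hL0 z hz)).symm) hz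
    have h2 := DFunLike.congr_fun h1 (0, b)
    rw [hA.fderiv_scalar_vert h hn' hz, fderiv_fun_mul (hdκ z hz) (hL.diff hz), hAκ z hz] at h2
    simp only [_root_.add_apply, _root_.smul_apply, smul_eq_mul] at h2
    have h3 : L z * fderiv ℝ κ z (0, b) = 0 := by linarith
    exact (mul_eq_zero.1 h3).resolve_left (hL0 z hz)
  have hh : ∀ z ∈ U, ∀ a : E, fderiv ℝ κ z (horLift X z a) = fderiv ℝ κ z (a, 0) := by
    intro z hz a
    have : horLift X z a = (a, 0) + (0, -connCoeff X z a) := by simp [horLift_apply]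
    rw [this, map_add, hv z hz, add_zero]
  -- In the horizontal derivative of `A = ½ κ d_J L` the term with the Hessian of `L` is symmetric,
  -- so horizontal closedness of `A` leaves `dκ ∧ d_J L = 0`.
  have h4 : ∀ z ∈ U, ∀ a c : E, fderiv ℝ κ z (c, 0) * fderiv ℝ L z (0, a)
      = fderiv ℝ κ z (a, 0) * fderiv ℝ L z (0, c) := by
    intro z hz a c
    have e : ∀ a c : E, fderiv ℝ A z (horLift X z c) a
        = 1 / 2 * (fderiv ℝ κ z (c, 0) * fderiv ℝ L z (0, a)
          + κ z * fderiv ℝ (fderiv ℝ L) z (horLift X z c) (0, a)) := by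
      intro a c
      have h1 := fderiv_congr_of_isOpen h.isOpen (fun z hz => hAκ z hz a) hz
      have hdL : DifferentiableAt ℝ (fun z => fderiv ℝ L z (0, a)) z :=
        (hL.diff_fderiv hz).clm_apply (differentiableAt_const _)
      rw [← fderiv_apply_const (hA.diff h hz), h1,
        fderiv_fun_mul (hdκ z hz) (hdL.const_mul _), fderiv_const_mul hdL]
      simp only [_root_.add_apply, _root_.smul_apply, smul_eq_mul, hh z hz,
        fderiv_apply_const (hL.diff_fderiv hz)]
      ring
    have h5 := hA.fderiv_horLift_symm h hn hz a c
    rw [e, e, h.hessian_horLift_symm hL hEL hz c a] at h5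
    linarith
  -- Vertical derivative of the previous relation; the `x`-derivatives of `κ` behave as constants
  -- because `κ` does not depend on `y`.
  have h5 : ∀ a b c : E, fderiv ℝ κ z (c, 0) * fderiv ℝ (fderiv ℝ L) z (0, b) (0, a)
      = fderiv ℝ κ z (a, 0) * fderiv ℝ (fderiv ℝ L) z (0, b) (0, c) := by
    intro a b c
    have e : ∀ a c : E, fderiv ℝ (fun z => fderiv ℝ κ z (c, 0) * fderiv ℝ L z (0, a)) z (0, b)
        = fderiv ℝ κ z (c, 0) * fderiv ℝ (fderiv ℝ L) z (0, b) (0, a) := by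
      intro a c
      have hdL : DifferentiableAt ℝ (fun z => fderiv ℝ L z (0, a)) z :=
        (hL.diff_fderiv hz).clm_apply (differentiableAt_const _)
      have hdk : DifferentiableAt ℝ (fun z => fderiv ℝ κ z (c, 0)) z :=
        (hdκ' z hz).clm_apply (differentiableAt_const _)
      have h0 : fderiv ℝ (fderiv ℝ κ) z (0, b) (c, 0) = 0 := by
        rw [fderiv_fderiv_symm h.isOpen hsm hz, ← fderiv_apply_const (hdκ' z hz),
          fderiv_congr_of_isOpen h.isOpen (fun z hz => hv z hz b) hz]
        simp
      rw [fderiv_fun_mul hdk hdL]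
      simp [fderiv_apply_const (hL.diff_fderiv hz), fderiv_apply_const (hdκ' z hz), h0]
    rw [← e, ← e]
    exact DFunLike.congr_fun (fderiv_congr_of_isOpen h.isOpen (fun z hz => h4 z hz a c) hz) _
  -- If `m = ∂κ/∂x` has `m c ≠ 0`, then any vector of `ker m` is `g`-orthogonal to everything, hence
  -- zero. Applied to `m(c) b - m(b) c`, this puts `b` on the line of `c`.
  have h6 : ∀ c : E, fderiv ℝ κ z (c, 0) = 0 := by
    by_contra! hc
    obtain ⟨c, hc⟩ := hc
    set m : E →L[ℝ] ℝ := (fderiv ℝ κ z).comp (ContinuousLinearMap.inl ℝ E E) with hm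
    have hm1 : ∀ a, m a = fderiv ℝ κ z (a, 0) := fun a => by simp [hm]
    obtain ⟨b, hb⟩ := exists_notMem_span_singleton hn' c
    have ha : fderiv ℝ κ z (m c • b - m b • c, 0) = 0 := by
      rw [← hm1]; simp; ring
    have : m c • b - m b • c = 0 := by
      refine hG z hz _ fun d => ?_
      have h7 := h5 (m c • b - m b • c) d c
      rw [ha, zero_mul] at h7
      exact (mul_eq_zero.1 h7).resolve_left hc
    refine hb ?_
    rw [← Submodule.smul_mem_iff _ (show m c ≠ 0 by rwa [hm1]), sub_eq_zero.1 this]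
    exact Submodule.smul_mem _ _ (Submodule.mem_span_singleton_self _)
  have h7 : fderiv ℝ κ z = 0 := by
    refine ContinuousLinearMap.ext fun u => ?_
    have : u = (u.1, 0) + (0, u.2) := by simp
    rw [this, map_add, h6, hv z hz]
    simp
  rw [← h7]
  exact (hdκ z hz).hasFDerivAt

end LocalIsotropic

end Isotropic

/-! ### Induced charts of the tangent bundle and coordinate expressions. -/

section Charts

variable {E : Type*} [NormedAddCommGroup E] [NormedSpace ℝ E]
  {M : Type*} [TopologicalSpace M] [ChartedSpace E M] [IsManifold 𝓘(ℝ, E) ∞ M]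

instance isManifold_tangentBundle :
    IsManifold (𝓘(ℝ, E).tangent) ∞ (TangentBundle 𝓘(ℝ, E) M) :=
  have : IsManifold 𝓘(ℝ, E) (∞ + 1) M := by simpa using ‹IsManifold 𝓘(ℝ, E) ∞ M›
  inferInstance

lemma tchart_target (x₀ : M) :
    (tchart E x₀).target = (extChartAt 𝓘(ℝ, E) x₀).target ×ˢ Set.univ := by
  unfold tchart
  rw [FiberBundle.extChartAt_target]
  congr 1
  refine Set.inter_eq_left.2 fun x hx => ?_
  simpa using (extChartAt 𝓘(ℝ, E) x₀).map_target hx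

lemma mem_slitTarget {x₀ : M} {z : E × E} :
    z ∈ slitTarget E x₀ ↔ z.1 ∈ (extChartAt 𝓘(ℝ, E) x₀).target ∧ z.2 ≠ 0 := by
  simp only [slitTarget, tchart_target, Set.mem_ofPred_eq, Set.mem_prod, Set.mem_univ, and_true]

lemma isOpen_slitTarget (x₀ : M) : IsOpen (slitTarget E x₀) := by
  have : slitTarget E x₀ = ((extChartAt 𝓘(ℝ, E) x₀).target ×ˢ {y | y ≠ 0} : Set (E × E)) := by
    ext z; simp [mem_slitTarget]
  rw [this]
  exact (isOpen_extChartAt_target x₀).prod isOpen_ne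

lemma mem_tchart_source {x₀ : M} {p : TangentBundle 𝓘(ℝ, E) M} :
    p ∈ (tchart E x₀).source ↔ p.1 ∈ (chartAt E x₀).source := by
  unfold tchart
  rw [extChartAt_source]
  exact TangentBundle.mem_chart_source_iff p _

lemma isOpen_tchart_source (x₀ : M) : IsOpen (tchart E x₀).source :=
  isOpen_extChartAt_source _

lemma tchart_apply {x₀ : M} {p : TangentBundle 𝓘(ℝ, E) M} (hp : p.1 ∈ (chartAt E x₀).source) :
    tchart E x₀ p = (extChartAt 𝓘(ℝ, E) x₀ p.1,
      (trivializationAt E (TangentSpace 𝓘(ℝ, E)) x₀).continuousLinearMapAt ℝ p.1 p.2) := by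
  unfold tchart
  rw [FiberBundle.extChartAt]
  rw [Bundle.Trivialization.continuousLinearMapAt_apply,
    Bundle.Trivialization.linearMapAt_apply, if_pos (by simpa using hp)]
  rfl

lemma tchart_symm_apply {x₀ : M} {z : E × E} (hz : z ∈ (tchart E x₀).target) :
    (tchart E x₀).symm z = ⟨(extChartAt 𝓘(ℝ, E) x₀).symm z.1,
      (trivializationAt E (TangentSpace 𝓘(ℝ, E)) x₀).symmL ℝ
        ((extChartAt 𝓘(ℝ, E) x₀).symm z.1) z.2⟩ := by
  have h1 : z.1 ∈ (extChartAt 𝓘(ℝ, E) x₀).target := by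
    rw [tchart_target] at hz; exact hz.1
  have h2 := (extChartAt 𝓘(ℝ, E) x₀).map_target h1
  rw [extChartAt_source] at h2
  set p : TangentBundle 𝓘(ℝ, E) M := ⟨(extChartAt 𝓘(ℝ, E) x₀).symm z.1,
      (trivializationAt E (TangentSpace 𝓘(ℝ, E)) x₀).symmL ℝ
        ((extChartAt 𝓘(ℝ, E) x₀).symm z.1) z.2⟩ with hp
  have h3 : p ∈ (tchart E x₀).source := mem_tchart_source.2 h2
  have h4 : tchart E x₀ p = z := by
    rw [tchart_apply h2, hp]
    refine Prod.ext ((extChartAt 𝓘(ℝ, E) x₀).right_inv h1) ?_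
    exact Bundle.Trivialization.continuousLinearMapAt_symmL _ (by simpa using h2) _
  rw [← h4, (tchart E x₀).left_inv h3]

lemma tchart_symm_smul {x₀ : M} {z : E × E} (hz : z ∈ (tchart E x₀).target) (c : ℝ) :
    (tchart E x₀).symm (z.1, c • z.2)
      = ⟨((tchart E x₀).symm z).1, c • ((tchart E x₀).symm z).2⟩ := by
  have hz' : (z.1, c • z.2) ∈ (tchart E x₀).target := by
    rw [tchart_target] at hz ⊢; exact ⟨hz.1, trivial⟩
  rw [tchart_symm_apply hz', tchart_symm_apply hz, map_smul]

lemma tchart_mem_slitTarget {x₀ : M} {p : TangentBundle 𝓘(ℝ, E) M}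
    (hp : p.1 ∈ (chartAt E x₀).source) (h0 : p ∈ slit E M) : tchart E x₀ p ∈ slitTarget E x₀ := by
  refine ⟨(tchart E x₀).map_source (mem_tchart_source.2 hp), fun h => h0 ?_⟩
  rw [tchart_apply hp] at h
  rw [← Bundle.Trivialization.symmL_continuousLinearMapAt (R := ℝ)
    (trivializationAt E (TangentSpace 𝓘(ℝ, E)) x₀) (by simpa using hp) p.2]
  simp only at h
  rw [h, map_zero]

lemma tchart_symm_mem_slit {x₀ : M} {z : E × E} (hz : z ∈ slitTarget E x₀) :
    (tchart E x₀).symm z ∈ slit E M := by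
  have h1 := (tchart E x₀).right_inv hz.1
  have h2 : ((tchart E x₀).symm z).1 ∈ (chartAt E x₀).source :=
    mem_tchart_source.1 ((tchart E x₀).map_target hz.1)
  intro h
  rw [tchart_apply h2, h, map_zero] at h1
  exact hz.2 (by rw [← h1])

lemma isOpen_slit : IsOpen (slit E M) := by
  rw [isOpen_iff_mem_nhds]
  intro p hp
  have hs : p.1 ∈ (chartAt E p.1).source := mem_chart_source E p.1
  have hc : ContinuousAt (tchart E p.1) p :=
    continuousAt_extChartAt' (mem_tchart_source.2 hs)
  filter_upwards [hc.preimage_mem_nhds ((isOpen_slitTarget p.1).mem_nhds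
    (tchart_mem_slitTarget hs hp)), (isOpen_tchart_source p.1).mem_nhds
    (mem_tchart_source.2 hs)] with q hq hq'
  have := tchart_symm_mem_slit hq
  rwa [(tchart E p.1).left_inv hq'] at this

lemma contMDiffOn_tchart_symm (x₀ : M) :
    ContMDiffOn 𝓘(ℝ, E × E) (𝓘(ℝ, E).tangent) ∞ (tchart E x₀).symm (tchart E x₀).target :=
  contMDiffOn_extChartAt_symm _

lemma contMDiffOn_tchart (x₀ : M) :
    ContMDiffOn (𝓘(ℝ, E).tangent) 𝓘(ℝ, E × E) ∞ (tchart E x₀) (tchart E x₀).source := by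
  unfold tchart
  rw [extChartAt_source]
  exact contMDiffOn_extChartAt

lemma contDiffOn_locFun {f : TangentBundle 𝓘(ℝ, E) M → ℝ}
    (hf : ContMDiffOn (𝓘(ℝ, E).tangent) 𝓘(ℝ, ℝ) ∞ f (slit E M)) (x₀ : M) :
    ContDiffOn ℝ ∞ (locFun f x₀) (slitTarget E x₀) := by
  rw [← contMDiffOn_iff_contDiffOn]
  exact hf.comp ((contMDiffOn_tchart_symm x₀).mono fun z hz => hz.1)
    fun z hz => tchart_symm_mem_slit hz

lemma contMDiffOn_of_locFun {f : TangentBundle 𝓘(ℝ, E) M → ℝ}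
    (hf : ∀ x₀ : M, ContDiffOn ℝ ∞ (locFun f x₀) (slitTarget E x₀)) :
    ContMDiffOn (𝓘(ℝ, E).tangent) 𝓘(ℝ, ℝ) ∞ f (slit E M) := by
  intro p hp
  have hs : p.1 ∈ (chartAt E p.1).source := mem_chart_source E p.1
  have hs' := (isOpen_tchart_source p.1).mem_nhds (mem_tchart_source.2 hs)
  have h1 : ContMDiffAt 𝓘(ℝ, E × E) 𝓘(ℝ, ℝ) ∞ (locFun f p.1) (tchart E p.1 p) :=
    ((hf p.1).contDiffAt ((isOpen_slitTarget p.1).mem_nhds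
      (tchart_mem_slitTarget hs hp))).contMDiffAt
  have h2 := h1.comp p ((contMDiffOn_tchart p.1).contMDiffAt hs')
  refine (h2.congr_of_eventuallyEq ?_).contMDiffWithinAt
  filter_upwards [hs'] with q hq
  simp only [Function.comp_apply, locFun, (tchart E p.1).left_inv hq]

/-- The trivialization of `T(TM)` centred at `⟨x₀, 0⟩` acts on fibres as the derivative of `tchart E
x₀`, so `locVec` is the fibre component of a smooth section read in the chart. -/
lemma contDiffOn_locVec
    {S : (p : TangentBundle 𝓘(ℝ, E) M) → TangentSpace (𝓘(ℝ, E).tangent) p}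
    (hS : ContMDiffOn (𝓘(ℝ, E).tangent) (𝓘(ℝ, E).tangent).tangent ∞
      (fun p => (⟨p, S p⟩ : TangentBundle (𝓘(ℝ, E).tangent) (TangentBundle 𝓘(ℝ, E) M)))
      (slit E M)) (x₀ : M) : ContDiffOn ℝ ∞ (locVec S x₀) (slitTarget E x₀) := by
  have : IsManifold (𝓘(ℝ, E).tangent) (∞ + 1) (TangentBundle 𝓘(ℝ, E) M) := by
    simpa using (isManifold_tangentBundle : IsManifold (𝓘(ℝ, E).tangent) ∞ _)
  have : ContMDiffVectorBundle ∞ (E × E)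
      (TangentSpace (𝓘(ℝ, E).tangent) : TangentBundle 𝓘(ℝ, E) M → Type _) (𝓘(ℝ, E).tangent) :=
    TangentBundle.contMDiffVectorBundle
  rw [← contMDiffOn_iff_contDiffOn]
  set p₀ : TangentBundle 𝓘(ℝ, E) M := ⟨x₀, 0⟩
  set e := trivializationAt (E × E)
    (TangentSpace (𝓘(ℝ, E).tangent) : TangentBundle 𝓘(ℝ, E) M → Type _) p₀
  have h1 : ∀ p ∈ (tchart E x₀).source, (e ⟨p, S p⟩).2
      = mfderiv (𝓘(ℝ, E).tangent) 𝓘(ℝ, E × E) (tchart E x₀) p (S p) := by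
    intro p hp
    have hp' : p ∈ (chartAt (ModelProd E E) p₀).source := by
      rw [← extChartAt_source (𝓘(ℝ, E).tangent)]; exact hp
    have h2 := TangentBundle.continuousLinearMapAt_trivializationAt
      (I := 𝓘(ℝ, E).tangent) (x₀ := p₀) hp'
    have h3 : e.continuousLinearMapAt ℝ p (S p) = (e ⟨p, S p⟩).2 := by
      rw [Bundle.Trivialization.continuousLinearMapAt_apply,
        Bundle.Trivialization.linearMapAt_apply, if_pos (by simpa [e] using hp')]
    exact h3.symm.trans (DFunLike.congr_fun h2 (S p))
  have h3 : ContMDiffOn (𝓘(ℝ, E).tangent) 𝓘(ℝ, E × E) ∞ (fun p => (e ⟨p, S p⟩).2)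
      (slit E M ∩ (tchart E x₀).source) := by
    intro p hp
    have hp' : p ∈ e.baseSet := by
      have : p ∈ (chartAt (ModelProd E E) p₀).source := by
        rw [← extChartAt_source (𝓘(ℝ, E).tangent)]; exact hp.2
      simpa [e] using this
    exact ((Bundle.Trivialization.contMDiffWithinAt_section (slit E M) hp').1
      (hS p hp.1)).mono Set.inter_subset_left
  refine ContMDiffOn.congr (h3.comp ((contMDiffOn_tchart_symm x₀).mono fun z hz => hz.1)
    fun z hz => ⟨tchart_symm_mem_slit hz, (tchart E x₀).map_target hz.1⟩) fun z hz => ?_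
  exact (h1 _ ((tchart E x₀).map_target hz.1)).symm

lemma mfderiv_tchart_symm_comp {x₀ : M} {z : E × E} (hz : z ∈ (tchart E x₀).target)
    (v : TangentSpace (𝓘(ℝ, E).tangent) ((tchart E x₀).symm z)) :
    mfderiv 𝓘(ℝ, E × E) (𝓘(ℝ, E).tangent) (tchart E x₀).symm z
      (mfderiv (𝓘(ℝ, E).tangent) 𝓘(ℝ, E × E) (tchart E x₀) ((tchart E x₀).symm z) v) = v := by
  have h1 := mfderivWithin_extChartAt_symm_comp_mfderiv_extChartAt
    (I := 𝓘(ℝ, E).tangent) (x := (⟨x₀, 0⟩ : TangentBundle 𝓘(ℝ, E) M)) hz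
  have h2 : Set.range (𝓘(ℝ, E).tangent) = Set.univ :=
    ModelWithCorners.Boundaryless.range_eq_univ
  rw [h2, mfderivWithin_univ] at h1
  exact DFunLike.congr_fun h1 v

lemma locForm_locVec {S : (p : TangentBundle 𝓘(ℝ, E) M) → TangentSpace (𝓘(ℝ, E).tangent) p}
    {α : (p : TangentBundle 𝓘(ℝ, E) M) → TangentSpace (𝓘(ℝ, E).tangent) p →L[ℝ] ℝ}
    {x₀ : M} {z : E × E} (hz : z ∈ (tchart E x₀).target) :
    locForm α x₀ z (locVec S x₀ z) = locFun (fun p => α p (S p)) x₀ z := by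
  exact congrArg (α _) (mfderiv_tchart_symm_comp hz _)

lemma IsSpray.localSpray {S : (p : TangentBundle 𝓘(ℝ, E) M) → TangentSpace (𝓘(ℝ, E).tangent) p}
    (hS : IsSpray S) (x₀ : M) : LocalSpray (locVec S x₀) (slitTarget E x₀) where
  isOpen := isOpen_slitTarget x₀
  smooth := contDiffOn_locVec hS.smooth x₀
  fst_eq z hz := congrArg Prod.snd (hS.tanJ_eq x₀ z hz)
  euler z hz := by
    have h1 := congrArg Prod.snd (hS.lieBracket_eq x₀ z hz)
    have hC : HasFDerivAt (liouville : E × E → E × E)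
      ((ContinuousLinearMap.inr ℝ E E).comp (ContinuousLinearMap.snd ℝ E E)) z :=
      ((ContinuousLinearMap.inr ℝ E E).comp (ContinuousLinearMap.snd ℝ E E)).hasFDerivAt
    rw [VectorField.lieBracket, hC.fderiv] at h1
    simp only [liouville, Prod.snd_sub, ContinuousLinearMap.comp_apply,
      ContinuousLinearMap.inr_apply, ContinuousLinearMap.coe_snd'] at h1
    rw [sub_eq_iff_eq_add.1 h1, two_smul]

end Charts

/-! ### From local to global: homogeneity, constancy, continuity at the zero section, the form `d_J
f`. -/

section Global

variable {E : Type*} [NormedAddCommGroup E] [NormedSpace ℝ E]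

/-- A positively homogeneous function of degree two, from Euler's relation. -/
lemma pos_homogeneous_of_euler {U : Set (E × E)} (hU : ∀ z ∈ U, ∀ t : ℝ, 0 < t → (z.1, t • z.2) ∈ U)
    {f : E × E → ℝ} (hd : ∀ z ∈ U, DifferentiableAt ℝ f z)
    (he : ∀ z ∈ U, fderiv ℝ f z (0, z.2) = 2 * f z) {z : E × E} (hz : z ∈ U) {c : ℝ} (hc : 0 < c) :
    f (z.1, c • z.2) = c ^ 2 * f z := by
  set g : ℝ → ℝ := fun t => f (z.1, t • z.2) / t ^ 2 with hg
  have hder : ∀ t ∈ Set.Ioi (0 : ℝ), HasDerivAt g 0 t := by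
    intro t ht
    have ht' : (0 : ℝ) < t := ht
    have hzt := hU z hz t ht
    have h1 : HasDerivAt (fun t : ℝ => (z.1, t • z.2)) (0, z.2) t := by
      have := (hasDerivAt_const t z.1).prodMk ((hasDerivAt_id t).smul_const z.2)
      simpa using this
    have h2 := (hd _ hzt).hasFDerivAt.comp_hasDerivAt t h1
    have h3 : fderiv ℝ f (z.1, t • z.2) (0, z.2) = 2 * f (z.1, t • z.2) / t := by
      have h4 := he _ hzt
      have h5 : ((0 : E), t • z.2) = t • (0, z.2) := by simp
      simp only [h5, map_smul, smul_eq_mul] at h4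
      rw [eq_div_iff ht'.ne', mul_comm, h4]
    have h6 := h2.div (hasDerivAt_pow 2 t) (by positivity)
    convert! h6 using 1
    simp only [Function.comp_apply, h3]
    field_simp
    simp
  have hconst := isOpen_Ioi.is_const_of_deriv_eq_zero (convex_Ioi (0 : ℝ)).isPreconnected
    (fun t ht => (hder t ht).differentiableAt.differentiableWithinAt)
    (fun t ht => (hder t ht).deriv) (Set.mem_Ioi.2 hc) (Set.mem_Ioi.2 one_pos)
  simp only [hg, one_smul, one_pow, div_one] at hconst
  rw [div_eq_iff (by positivity)] at hconst
  rw [hconst, mul_comm]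

/-- Euler's relation for a positively homogeneous function of degree two. -/
lemma euler_of_homogeneous {f : E × E → ℝ} {z : E × E} (hd : DifferentiableAt ℝ f z)
    (hf : ∀ c : ℝ, 0 ≤ c → f (z.1, c • z.2) = c ^ 2 * f z) :
    fderiv ℝ f z (0, z.2) = 2 * f z := by
  have h1 : HasDerivAt (fun t : ℝ => (z.1, t • z.2)) (0, z.2) 1 := by
    have := (hasDerivAt_const (1 : ℝ) z.1).prodMk ((hasDerivAt_id (1 : ℝ)).smul_const z.2)
    simpa using this
  have hd' : HasFDerivAt f (fderiv ℝ f z) (z.1, (1 : ℝ) • z.2) := by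
    simpa using hd.hasFDerivAt
  have h2 := hd'.comp_hasDerivAt 1 h1
  have h3 : HasDerivAt (fun t : ℝ => t ^ 2 * f z) (2 * f z) 1 := by
    simpa using (hasDerivAt_pow 2 (1 : ℝ)).mul_const (f z)
  refine h2.unique (h3.congr_of_eventuallyEq ?_)
  filter_upwards [Ioi_mem_nhds (one_pos : (0 : ℝ) < 1)] with t ht
  exact hf t (le_of_lt ht)

variable {M : Type*} [TopologicalSpace M] [ChartedSpace E M] [IsManifold 𝓘(ℝ, E) ∞ M]

lemma smul_mem_slitTarget {x₀ : M} {z : E × E} (hz : z ∈ slitTarget E x₀) {t : ℝ} (ht : t ≠ 0) :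
    (z.1, t • z.2) ∈ slitTarget E x₀ :=
  mem_slitTarget.2 ⟨(mem_slitTarget.1 hz).1, smul_ne_zero ht (mem_slitTarget.1 hz).2⟩

/-- A function on `T₀M` with vanishing derivative is constant. -/
lemma exists_const_of_fderiv_eq_zero [FiniteDimensional ℝ E] [ConnectedSpace M]
    (hn : 2 ≤ Module.finrank ℝ E) {f : TangentBundle 𝓘(ℝ, E) M → ℝ}
    (hf : ∀ x₀ : M, ∀ z ∈ slitTarget E x₀, HasFDerivAt (locFun f x₀) (0 : E × E →L[ℝ] ℝ) z) :
    ∃ k : ℝ, ∀ p ∈ slit E M, f p = k := by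
  have hloc : ∀ m : M, ∃ k : ℝ, ∀ᶠ m' in nhds m, ∀ v : TangentSpace 𝓘(ℝ, E) m', v ≠ 0 →
      f ⟨m', v⟩ = k := by
    intro m
    obtain ⟨r, hr, hB⟩ := Metric.isOpen_iff.1 (isOpen_extChartAt_target (I := 𝓘(ℝ, E)) m)
      _ (mem_extChartAt_target m)
    -- A ball times the punctured model space is connected since `dim E ≥ 2`; hence a single
    -- constant serves on all the slit fibres near `m`.
    set W : Set (E × E) := Metric.ball (extChartAt 𝓘(ℝ, E) m m) r ×ˢ {0}ᶜ with hW
    have hWU : W ⊆ slitTarget E m := fun z hz => mem_slitTarget.2 ⟨hB hz.1, hz.2⟩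
    have hWo : IsOpen W := Metric.isOpen_ball.prod isOpen_compl_singleton
    have hrank : 1 < Module.rank ℝ E := by
      rw [← Module.finrank_eq_rank]
      exact_mod_cast hn
    have hWc : IsPreconnected W := (convex_ball _ _).isPreconnected.prod
      (isConnected_compl_singleton_of_one_lt_rank hrank 0).isPreconnected
    obtain ⟨k, hk⟩ := hWo.exists_is_const_of_fderiv_eq_zero hWc
      (fun z hz => (hf m z (hWU hz)).differentiableAt.differentiableWithinAt)
      (fun z hz => (hf m z (hWU hz)).fderiv)
    refine ⟨k, ?_⟩
    filter_upwards [(continuousAt_extChartAt (I := 𝓘(ℝ, E)) m).preimage_mem_nhds (Metric.ball_mem_nhds _ hr),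
      (chartAt E m).open_source.mem_nhds (mem_chart_source E m)] with m' h1 h2 v hv
    have hp : tchart E m ⟨m', v⟩ ∈ slitTarget E m :=
      tchart_mem_slitTarget (p := ⟨m', v⟩) h2 hv
    have h3 : tchart E m ⟨m', v⟩ ∈ W := by
      refine ⟨?_, hp.2⟩
      rw [tchart_apply (p := ⟨m', v⟩) h2]
      exact h1
    rw [← hk _ h3, locFun, (tchart E m).left_inv (mem_tchart_source.2 h2)]
  have : Nontrivial E := Module.nontrivial_of_finrank_pos (R := ℝ) (by omega)
  obtain ⟨v₀, hv₀⟩ := exists_ne (0 : E)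
  -- The fixed model vector `v₀` need not form a continuous vector field: near each point `f` takes
  -- one value on every non-zero vector, so any choice in the fibres gives a locally constant
  -- function.
  set lam : M → ℝ := fun m => f ⟨m, (v₀ : E)⟩ with hlam
  have hconst : IsLocallyConstant lam := by
    rw [IsLocallyConstant.iff_eventually_eq]
    intro m
    obtain ⟨k, hk⟩ := hloc m
    filter_upwards [hk] with m' hm'
    exact (hm' v₀ hv₀).trans (hk.self_of_nhds v₀ hv₀).symm
  obtain ⟨k, hk⟩ := hconst.exists_eq_const
  refine ⟨k, fun p hp => ?_⟩
  obtain ⟨k', hk'⟩ := hloc p.1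
  have h1 := hk'.self_of_nhds p.2 hp
  have h2 := hk'.self_of_nhds v₀ hv₀
  have h3 : lam p.1 = k := congrFun hk p.1
  exact (h1.trans h2.symm).trans h3

/-- A function on `TM` that is continuous on `T₀M` and positively homogeneous of degree one is
continuous. -/
lemma continuous_of_homogeneous [FiniteDimensional ℝ E] {F : TangentBundle 𝓘(ℝ, E) M → ℝ}
    (hF : ContinuousOn F (slit E M))
    (hh : ∀ (p : TangentBundle 𝓘(ℝ, E) M) (c : ℝ), 0 ≤ c → F ⟨p.1, c • p.2⟩ = c * F p) :
    Continuous F := by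
  rw [continuous_iff_continuousAt]
  intro p
  by_cases hp : p ∈ slit E M
  · exact hF.continuousAt (isOpen_slit.mem_nhds hp)
  have hp0 : p.2 = 0 := not_not.1 hp
  have hF0 : ∀ q : TangentBundle 𝓘(ℝ, E) M, q.2 = 0 → F q = 0 := by
    intro q hq
    have := hh q 0 le_rfl
    rw [zero_mul, zero_smul, ← hq] at this
    exact this
  set m := p.1
  have hs : p.1 ∈ (chartAt E m).source := mem_chart_source E p.1
  obtain ⟨r, hr, hB⟩ := Metric.nhds_basis_closedBall.mem_iff.1
    ((isOpen_extChartAt_target (I := 𝓘(ℝ, E)) m).mem_nhds (mem_extChartAt_target m))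
  -- A bound `C` for `F` over a compact neighbourhood and the unit sphere of directions becomes `|F|
  -- ≤ C ‖y‖` by homogeneity, which forces continuity at the zero section.
  set K : Set (E × E) := Metric.closedBall (extChartAt 𝓘(ℝ, E) m m) r ×ˢ Metric.sphere 0 1
  have hK : IsCompact K := (isCompact_closedBall _ _).prod (isCompact_sphere _ _)
  have hKU : K ⊆ slitTarget E m := fun z hz =>
    mem_slitTarget.2 ⟨hB hz.1, fun h0 => by
      have := hz.2
      simp [h0] at this⟩
  have hcont : ContinuousOn (locFun F m) K := by
    refine ContinuousOn.comp (t := slit E M) hF ?_ fun z hz => tchart_symm_mem_slit (hKU hz)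
    exact ((contMDiffOn_tchart_symm m).continuousOn).mono fun z hz => (hKU hz).1
  obtain ⟨C, hC⟩ := hK.exists_bound_of_continuousOn hcont
  have hbound : ∀ᶠ q in nhds p, ‖F q‖ ≤ ‖(tchart E m q).2‖ * C := by
    have hct : ContinuousAt (fun q : TangentBundle 𝓘(ℝ, E) M => extChartAt 𝓘(ℝ, E) m q.1) p :=
      ContinuousAt.comp (f := fun q : TangentBundle 𝓘(ℝ, E) M => q.1)
        (continuousAt_extChartAt m)
        (Bundle.contMDiff_proj (n := 0) (IB := 𝓘(ℝ, E))
          (TangentSpace 𝓘(ℝ, E) : M → Type _)).continuous.continuousAt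
    filter_upwards [hct.preimage_mem_nhds (Metric.closedBall_mem_nhds _ hr),
      (isOpen_tchart_source m).mem_nhds (mem_tchart_source.2 hs)] with q h1 h2
    by_cases hq : q ∈ slit E M
    · have h3 := mem_tchart_source.1 h2
      have h4 := tchart_mem_slitTarget h3 hq
      set z := tchart E m q with hz
      have hz1 : z.1 ∈ Metric.closedBall (extChartAt 𝓘(ℝ, E) m m) r := by
        rw [hz, tchart_apply h3]; exact h1
      have hn : ‖z.2‖ ≠ 0 := norm_ne_zero_iff.2 h4.2
      have h5 := hC (z.1, ‖z.2‖⁻¹ • z.2) ⟨hz1, by simp [norm_smul, hn]⟩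
      have h6 : locFun F m (z.1, ‖z.2‖⁻¹ • z.2) = ‖z.2‖⁻¹ * F q := by
        rw [locFun, tchart_symm_smul h4.1, hh _ _ (by positivity), hz, (tchart E m).left_inv h2]
      rw [h6, norm_mul, norm_inv, norm_norm, inv_mul_le_iff₀ (by positivity)] at h5
      exact h5
    · have h3 := mem_tchart_source.1 h2
      have h4 : q.2 = 0 := not_not.1 hq
      rw [hF0 q h4, tchart_apply h3, h4]
      simp
  have hlim : Filter.Tendsto (fun q => ‖(tchart E m q).2‖ * C) (nhds p) (nhds 0) := by
    have h1 : ContinuousAt (tchart E m) p := continuousAt_extChartAt' (mem_tchart_source.2 hs)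
    have h2 : ContinuousAt (fun q => ‖(tchart E m q).2‖ * C) p :=
      ((continuous_snd.continuousAt.comp h1).norm).mul continuousAt_const
    have h3 : ‖(tchart E m p).2‖ * C = 0 := by
      rw [tchart_apply hs, hp0]; simp
    rw [← h3]
    exact h2
  rw [ContinuousAt, hF0 p hp0]
  exact squeeze_zero_norm' hbound hlim

/-- The `1`-form `d_J f` of a function `f` on `TM`: the derivative of `f` along the fibre, in the
direction of the projection to `M`. -/
def vertForm (f : TangentBundle 𝓘(ℝ, E) M → ℝ) (p : TangentBundle 𝓘(ℝ, E) M) :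
    TangentSpace (𝓘(ℝ, E).tangent) p →L[ℝ] ℝ :=
  ((fderiv ℝ (fun w : E => f ⟨p.1, w⟩) p.2 : E →L[ℝ] ℝ) :
      TangentSpace 𝓘(ℝ, E) p.1 →L[ℝ] ℝ).comp
    (mfderiv (𝓘(ℝ, E).tangent) 𝓘(ℝ, E)
      (fun q : TangentBundle 𝓘(ℝ, E) M => q.1) p)

/-- Provides a form on `TM` with prescribed coordinate expressions, needed to exhibit `α` globally.
The chart is linear on fibres: the derivative along the fibre brings in its fibre coordinate map,
the projection to `M` the inverse of that map, and the two cancel. -/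
lemma locForm_vertForm {f : TangentBundle 𝓘(ℝ, E) M → ℝ} {x₀ : M} {z : E × E}
    (hz : z ∈ slitTarget E x₀) (hf : DifferentiableAt ℝ (locFun f x₀) z) :
    locForm (vertForm f) x₀ z = dFun tanJ (locFun f x₀) z := by
  have hz1 := (mem_slitTarget.1 hz).1
  have hb : (extChartAt 𝓘(ℝ, E) x₀).symm z.1 ∈ (chartAt E x₀).source := by
    have := (extChartAt 𝓘(ℝ, E) x₀).map_target hz1
    rwa [extChartAt_source] at this
  set e := trivializationAt E (TangentSpace 𝓘(ℝ, E)) x₀ with he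
  set b : M := (extChartAt 𝓘(ℝ, E) x₀).symm z.1 with hbdef
  have hbe : b ∈ e.baseSet := by simpa [he] using hb
  have hp := tchart_symm_apply hz.1
  have hproj : ∀ u : E × E, mfderiv (𝓘(ℝ, E).tangent) 𝓘(ℝ, E)
      (fun q : TangentBundle 𝓘(ℝ, E) M => q.1) ((tchart E x₀).symm z)
      (mfderiv 𝓘(ℝ, E × E) (𝓘(ℝ, E).tangent) (tchart E x₀).symm z u) = e.symmL ℝ b u.1 := by
    intro u
    have htn : (tchart E x₀).target ∈ nhds z :=
      Filter.mem_of_superset ((isOpen_slitTarget x₀).mem_nhds hz) fun z hz => hz.1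
    have hd1 : MDifferentiableAt (𝓘(ℝ, E).tangent) 𝓘(ℝ, E)
        (fun q : TangentBundle 𝓘(ℝ, E) M => q.1) ((tchart E x₀).symm z) :=
      Bundle.mdifferentiable_proj (TangentSpace 𝓘(ℝ, E) : M → Type _) _
    have hd2 : MDifferentiableAt 𝓘(ℝ, E × E) (𝓘(ℝ, E).tangent) (tchart E x₀).symm z :=
      ((contMDiffOn_tchart_symm x₀).contMDiffAt htn).mdifferentiableAt (by simp)
    have hd3 : MDifferentiableAt 𝓘(ℝ, E) 𝓘(ℝ, E) (extChartAt 𝓘(ℝ, E) x₀).symm z.1 :=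
      ((contMDiffOn_extChartAt_symm (n := ∞) x₀).contMDiffAt
        ((isOpen_extChartAt_target x₀).mem_nhds hz1)).mdifferentiableAt (by simp)
    have hd4 : MDifferentiableAt 𝓘(ℝ, E × E) 𝓘(ℝ, E) (Prod.fst : E × E → E) z :=
      differentiableAt_fst.mdifferentiableAt
    have h1 := mfderiv_comp_apply z hd1 hd2 u
    have h2 : ((fun q : TangentBundle 𝓘(ℝ, E) M => q.1) ∘ (tchart E x₀).symm) =ᶠ[nhds z]
        ((extChartAt 𝓘(ℝ, E) x₀).symm ∘ Prod.fst) := by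
      filter_upwards [htn] with z' hz'
      simp only [Function.comp_apply, tchart_symm_apply hz']
    have h3 := mfderiv_comp_apply z hd3 hd4 u
    have h4 := TangentBundle.symmL_trivializationAt (I := 𝓘(ℝ, E)) hb
    have h5 : Set.range (𝓘(ℝ, E)) = Set.univ := ModelWithCorners.Boundaryless.range_eq_univ
    rw [h5, mfderivWithin_univ, hbdef, (extChartAt 𝓘(ℝ, E) x₀).right_inv hz1] at h4
    have h6 : mfderiv 𝓘(ℝ, E × E) 𝓘(ℝ, E) (Prod.fst : E × E → E) z u = u.1 := by
      rw [mfderiv_eq_fderiv, _root_.fderiv_fst]; rfl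
    have h7 : mfderiv 𝓘(ℝ, E × E) 𝓘(ℝ, E)
        ((fun q : TangentBundle 𝓘(ℝ, E) M => q.1) ∘ (tchart E x₀).symm) z u
        = mfderiv 𝓘(ℝ, E) 𝓘(ℝ, E) (extChartAt 𝓘(ℝ, E) x₀).symm z.1 u.1 := by
      rw [h2.mfderiv_eq, ← h6]; exact h3
    exact h1.symm.trans (h7.trans (DFunLike.congr_fun h4 u.1).symm)
  have hfib : fderiv ℝ (fun w : E => f ⟨b, w⟩) (e.symmL ℝ b z.2)
      = ((fderiv ℝ (locFun f x₀) z).comp (ContinuousLinearMap.inr ℝ E E)).comp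
        (e.continuousLinearMapAt ℝ b : E →L[ℝ] E) := by
    have h1 : (fun w : E => f ⟨b, w⟩)
        = fun w : E => locFun f x₀ (z.1, (e.continuousLinearMapAt ℝ b : E →L[ℝ] E) w) := by
      funext w
      have hzt : (z.1, (e.continuousLinearMapAt ℝ b : E →L[ℝ] E) w) ∈ (tchart E x₀).target := by
        rw [tchart_target]; exact ⟨hz1, trivial⟩
      rw [locFun, tchart_symm_apply hzt]
      exact congrArg (fun v : TangentSpace 𝓘(ℝ, E) b => f ⟨b, v⟩)
        (e.symmL_continuousLinearMapAt hbe w).symm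
    have h2 : (e.continuousLinearMapAt ℝ b : E →L[ℝ] E) (e.symmL ℝ b z.2) = z.2 :=
      e.continuousLinearMapAt_symmL hbe z.2
    have h3 : ∀ w₀ : E, (e.continuousLinearMapAt ℝ b : E →L[ℝ] E) w₀ = z.2 →
        fderiv ℝ (fun w : E => locFun f x₀ (z.1, (e.continuousLinearMapAt ℝ b : E →L[ℝ] E) w)) w₀
          = ((fderiv ℝ (locFun f x₀) z).comp (ContinuousLinearMap.inr ℝ E E)).comp
            (e.continuousLinearMapAt ℝ b : E →L[ℝ] E) := by
      intro w₀ hw₀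
      have h4 : HasFDerivAt (fun w : E => (z.1, (e.continuousLinearMapAt ℝ b : E →L[ℝ] E) w))
          ((ContinuousLinearMap.inr ℝ E E).comp (e.continuousLinearMapAt ℝ b : E →L[ℝ] E)) w₀ :=
        (hasFDerivAt_const z.1 w₀).prodMk (e.continuousLinearMapAt ℝ b : E →L[ℝ] E).hasFDerivAt
      have h5 : HasFDerivAt (locFun f x₀) (fderiv ℝ (locFun f x₀) z)
          (z.1, (e.continuousLinearMapAt ℝ b : E →L[ℝ] E) w₀) := by
        rw [hw₀]; exact hf.hasFDerivAt
      exact (h5.comp w₀ h4).fderiv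
    rw [h1]
    exact h3 _ h2
  refine ContinuousLinearMap.ext fun u => ?_
  have h1 : locForm (vertForm f) x₀ z u
      = fderiv ℝ (fun w : E => f ⟨((tchart E x₀).symm z).1, w⟩) ((tchart E x₀).symm z).2
        (mfderiv (𝓘(ℝ, E).tangent) 𝓘(ℝ, E)
      (fun q : TangentBundle 𝓘(ℝ, E) M => q.1) ((tchart E x₀).symm z)
      (mfderiv 𝓘(ℝ, E × E) (𝓘(ℝ, E).tangent) (tchart E x₀).symm z u)) := rfl
  have h2 : fderiv ℝ (fun w : E => f ⟨((tchart E x₀).symm z).1, w⟩) ((tchart E x₀).symm z).2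
      = fderiv ℝ (fun w : E => f ⟨b, w⟩) (e.symmL ℝ b z.2) := by rw [hp]
  refine h1.trans ?_
  rw [h2, hfib]
  have h3 := congrArg (e.continuousLinearMapAt ℝ b : E →L[ℝ] E) (hproj u)
  have h4 : (e.continuousLinearMapAt ℝ b : E →L[ℝ] E) (e.symmL ℝ b u.1) = u.1 :=
    e.continuousLinearMapAt_symmL hbe u.1
  exact congrArg (fun v : E => fderiv ℝ (locFun f x₀) z (0, v)) (h3.trans h4)

end Global

/-! ### Ricci curvature from the form of the Jacobi endomorphism. -/

section Traces

variable {E : Type*} [NormedAddCommGroup E] [NormedSpace ℝ E] [FiniteDimensional ℝ E]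

lemma ricci_eq_of_jacobiCoeff {X : E × E → E × E} {z : E × E} {r : ℝ} {B : E →L[ℝ] ℝ} {y : E}
    (h : ∀ a, jacobiCoeff X z a = r • a - B a • y) :
    ricci X z = Module.finrank ℝ E * r - B y := by
  have h1 : (jacobiCoeff X z).toLinearMap
      = r • LinearMap.id - (B.toLinearMap).smulRight y := by
    ext a
    simpa using h a
  change LinearMap.trace ℝ E (jacobiCoeff X z).toLinearMap = _
  rw [h1, map_sub, map_smul, LinearMap.trace_id, LinearMap.trace_smulRight]
  simp [mul_comm]

lemma ricciScalar_eq_of_jacobiCoeff (hn : 2 ≤ Module.finrank ℝ E) {X : E × E → E × E} {z : E × E}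
    {r : ℝ} {B : E →L[ℝ] ℝ} {y : E} (h : ∀ a, jacobiCoeff X z a = r • a - B a • y) (hB : B y = r) :
    ricciScalar X z = r := by
  have : (2 : ℝ) ≤ Module.finrank ℝ E := by exact_mod_cast hn
  rw [ricciScalar, ricci_eq_of_jacobiCoeff h, hB, div_eq_iff (by linarith)]
  ring

omit [FiniteDimensional ℝ E] in
lemma ricci_eq_mul_ricciScalar (hn : 2 ≤ Module.finrank ℝ E) (X : E × E → E × E) (z : E × E) :
    ricci X z = ((Module.finrank ℝ E : ℝ) - 1) * ricciScalar X z := by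
  have : (2 : ℝ) ≤ Module.finrank ℝ E := by exact_mod_cast hn
  have h1 : (Module.finrank ℝ E : ℝ) - 1 ≠ 0 := by linarith
  rw [ricciScalar, mul_div_cancel₀ _ h1]

end Traces

/-! ### Regularity of the metric tensor as nondegeneracy of the vertical Hessian. -/

section Metric

variable {E : Type*} [NormedAddCommGroup E] [NormedSpace ℝ E] {U : Set (E × E)} {z : E × E}

lemma LocalEnergy.congr {L L' : E × E → ℝ} (hL : LocalEnergy L U) (h : ∀ z ∈ U, L' z = L z) :
    LocalEnergy L' U where
  isOpen := hL.isOpen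
  smooth := hL.smooth.congr h
  euler z hz := by rw [fderiv_congr_of_isOpen hL.isOpen h hz, hL.euler z hz, h z hz]

lemma LocalEnergy.const_mul {L : E × E → ℝ} (hL : LocalEnergy L U) (c : ℝ) :
    LocalEnergy (fun z => c * L z) U where
  isOpen := hL.isOpen
  smooth := contDiffOn_const.mul hL.smooth
  euler z hz := by
    rw [fderiv_const_mul (hL.diff hz)]
    simp only [_root_.smul_apply, smul_eq_mul, hL.euler z hz]
    ring

lemma VertNondegenerate.const_mul {L L' : E × E → ℝ} (hL : LocalEnergy L U)
    (hG : VertNondegenerate L U) {c : ℝ} (hc : c ≠ 0) (h : ∀ z ∈ U, L' z = c * L z) :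
    VertNondegenerate L' U := by
  intro z hz a ha
  refine hG z hz a fun b => ?_
  have h1 : ∀ z ∈ U, fderiv ℝ L' z = c • fderiv ℝ L z := fun z hz => by
    rw [fderiv_congr_of_isOpen hL.isOpen h hz, fderiv_const_mul (hL.diff hz)]
  have h2 := ha b
  rw [fderiv_congr_of_isOpen hL.isOpen h1 hz, fderiv_fun_const_smul (hL.diff_fderiv hz)] at h2
  simpa [hc] using h2

lemma metricTensor_apply {f : E × E → ℝ} (hL : LocalEnergy (fun z => f z ^ 2) U) (hz : z ∈ U)
    (a b : E) : metricTensor f z a b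
      = 1 / 2 * fderiv ℝ (fderiv ℝ fun z => f z ^ 2) z (0, a) (0, b) := by
  have hi : ∀ y : E, HasFDerivAt (fun y : E => (z.1, y)) (ContinuousLinearMap.inr ℝ E E) y :=
    fun y => hasFDerivAt_prodMk_right z.1 y
  have h1 : ∀ᶠ y in nhds z.2, fderiv ℝ (fun y' => (1 / 2 : ℝ) * f (z.1, y') ^ 2) y
      = (1 / 2 : ℝ) • (fderiv ℝ (fun z => f z ^ 2) (z.1, y)).comp
        (ContinuousLinearMap.inr ℝ E E) := by
    have hc : ContinuousAt (fun y : E => (z.1, y)) z.2 := (hi z.2).continuousAt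
    filter_upwards [hc.preimage_mem_nhds (hL.isOpen.mem_nhds hz)] with y hy
    exact (((hL.diff hy).hasFDerivAt.comp y (hi y)).const_mul (1 / 2 : ℝ)).fderiv
  have h2 : HasFDerivAt (fun y => fderiv ℝ (fun z => f z ^ 2) (z.1, y))
      ((fderiv ℝ (fderiv ℝ fun z => f z ^ 2) z).comp (ContinuousLinearMap.inr ℝ E E)) z.2 :=
    (hL.diff_fderiv hz).hasFDerivAt.comp z.2 (hi z.2)
  have h3 := (h2.clm_comp (hasFDerivAt_const (ContinuousLinearMap.inr ℝ E E) z.2)).const_smul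
    (1 / 2 : ℝ)
  rw [metricTensor, Filter.EventuallyEq.fderiv_eq h1]
  have h4 := congrArg (fun A => A a b) h3.fderiv
  refine h4.trans ?_
  simp

lemma finrank_metricTensor_iff [FiniteDimensional ℝ E] {f : E × E → ℝ}
    (hL : LocalEnergy (fun z => f z ^ 2) U) (hz : z ∈ U) :
    Module.finrank ℝ (metricTensor f z).range = Module.finrank ℝ E ↔
      ∀ a : E, (∀ b : E, fderiv ℝ (fderiv ℝ fun z => f z ^ 2) z (0, b) (0, a) = 0) → a = 0 := by
  have h1 := LinearMap.finrank_range_add_finrank_ker (metricTensor f z).toLinearMap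
  have h2 : (∀ a, metricTensor f z a = 0 → a = 0) ↔
      Module.finrank ℝ (LinearMap.ker (metricTensor f z).toLinearMap) = 0 := by
    rw [Submodule.finrank_eq_zero, LinearMap.ker_eq_bot']; rfl
  have h3 : ∀ a, metricTensor f z a = 0 ↔
      ∀ b : E, fderiv ℝ (fderiv ℝ fun z => f z ^ 2) z (0, b) (0, a) = 0 := by
    intro a
    rw [ContinuousLinearMap.ext_iff]
    refine forall_congr' fun b => ?_
    rw [metricTensor_apply hL hz, hL.symm hz]
    simp
  simp only [← h3]
  rw [h2]
  constructor <;> intro h4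
  · have : Module.finrank ℝ (LinearMap.range (metricTensor f z).toLinearMap)
      = Module.finrank ℝ E := h4
    omega
  · omega

end Metric

/-! ### Finsler functions and flag curvature in coordinates, with `F d_J F = ½ d_J F²`. -/

section Finsler

variable {E : Type*} [NormedAddCommGroup E] [NormedSpace ℝ E]
  {M : Type*} [TopologicalSpace M] [ChartedSpace E M] [IsManifold 𝓘(ℝ, E) ∞ M]
  {F : TangentBundle 𝓘(ℝ, E) M → ℝ}
  {S : (p : TangentBundle 𝓘(ℝ, E) M) → TangentSpace (𝓘(ℝ, E).tangent) p}

lemma IsFinsler.locFun_pos (hF : IsFinsler F) {x₀ : M} {z : E × E} (hz : z ∈ slitTarget E x₀) :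
    0 < locFun F x₀ z :=
  hF.pos _ (tchart_symm_mem_slit hz)

lemma locFun_homogeneous
    (hF : ∀ (p : TangentBundle 𝓘(ℝ, E) M) (c : ℝ), 0 ≤ c → F ⟨p.1, c • p.2⟩ = c * F p)
    {x₀ : M} {z : E × E} (hz : z ∈ slitTarget E x₀) {c : ℝ} (hc : 0 ≤ c) :
    locFun F x₀ (z.1, c • z.2) = c * locFun F x₀ z := by
  rw [locFun, tchart_symm_smul hz.1, hF _ _ hc, locFun]

lemma localEnergy_sq
    (hs : ∀ x₀ : M, ContDiffOn ℝ ∞ (locFun F x₀) (slitTarget E x₀))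
    (hF : ∀ (p : TangentBundle 𝓘(ℝ, E) M) (c : ℝ), 0 ≤ c → F ⟨p.1, c • p.2⟩ = c * F p) (x₀ : M) :
    LocalEnergy (fun z => locFun F x₀ z ^ 2) (slitTarget E x₀) where
  isOpen := isOpen_slitTarget x₀
  smooth := (hs x₀).pow 2
  euler z hz := by
    refine euler_of_homogeneous (f := fun z => locFun F x₀ z ^ 2)
      (differentiableAt_of_smoothOn (isOpen_slitTarget x₀) ((hs x₀).pow 2) hz) fun c hc => ?_
    simp only [locFun_homogeneous hF hz hc]
    ring

lemma IsFinsler.localEnergy (hF : IsFinsler F) (x₀ : M) :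
    LocalEnergy (fun z => locFun F x₀ z ^ 2) (slitTarget E x₀) :=
  localEnergy_sq (contDiffOn_locFun hF.smooth) hF.homogeneous x₀

lemma IsFinsler.vertNondegenerate [FiniteDimensional ℝ E] (hF : IsFinsler F) (x₀ : M) :
    VertNondegenerate (fun z => locFun F x₀ z ^ 2) (slitTarget E x₀) := fun z hz =>
  (finrank_metricTensor_iff (hF.localEnergy x₀) hz).1 (hF.regular x₀ z hz)

lemma IsMetrizableBy.eulerLagrange (hS : IsSpray S) (hF : IsMetrizableBy F S) (x₀ : M) :
    EulerLagrange (locVec S x₀) (fun z => locFun F x₀ z ^ 2) (slitTarget E x₀) := fun z hz =>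
  ((hF.1.localEnergy x₀).eulerLagrange_iff (hS.localSpray x₀).fst_eq hz).1 (hF.2 x₀ z hz)

lemma fderiv_locFun_sq (hs : ∀ x₀ : M, ContDiffOn ℝ ∞ (locFun F x₀) (slitTarget E x₀))
    {x₀ : M} {z : E × E} (hz : z ∈ slitTarget E x₀) (u : E × E) :
    fderiv ℝ (fun z => locFun F x₀ z ^ 2) z u = 2 * locFun F x₀ z * fderiv ℝ (locFun F x₀) z u := by
  rw [fderiv_fun_pow 2 (differentiableAt_of_smoothOn (isOpen_slitTarget x₀) (hs x₀) hz)]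
  simp

/-- The Jacobi endomorphism of a metric of flag curvature `κ`, in coordinates. -/
lemma HasFlagCurvature.jacobiCoeff_eq {κ : TangentBundle 𝓘(ℝ, E) M → ℝ}
    (hs : ∀ x₀ : M, ContDiffOn ℝ ∞ (locFun F x₀) (slitTarget E x₀))
    (hκ : HasFlagCurvature F S κ) {x₀ : M} {z : E × E} (hz : z ∈ slitTarget E x₀) (a : E) :
    jacobiCoeff (locVec S x₀) z a = (locFun κ x₀ z * locFun F x₀ z ^ 2) • a
      - (locFun κ x₀ z * (1 / 2 * fderiv ℝ (fun z => locFun F x₀ z ^ 2) z (0, a))) • z.2 := by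
  rw [jacobiCoeff, hκ x₀ z hz, fderiv_locFun_sq hs hz]
  simp only [ContinuousLinearMap.comp_apply, _root_.smul_apply, _root_.sub_apply,
    ContinuousLinearMap.smulRight_apply, ContinuousLinearMap.inl_apply, tanJ_apply, dFun, liouville,
    ContinuousLinearMap.coe_snd', Prod.smul_snd, Prod.snd_sub, smul_eq_mul]
  module

lemma hasFlagCurvature_of_jacobiCoeff_eq {κ : TangentBundle 𝓘(ℝ, E) M → ℝ} (hS : IsSpray S)
    (hs : ∀ x₀ : M, ContDiffOn ℝ ∞ (locFun F x₀) (slitTarget E x₀))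
    (h : ∀ x₀ : M, ∀ z ∈ slitTarget E x₀, ∀ a : E, jacobiCoeff (locVec S x₀) z a
      = (locFun κ x₀ z * locFun F x₀ z ^ 2) • a
      - (locFun κ x₀ z * (1 / 2 * fderiv ℝ (fun z => locFun F x₀ z ^ 2) z (0, a))) • z.2) :
    HasFlagCurvature F S κ := by
  intro x₀ z hz
  refine ContinuousLinearMap.ext fun u => ?_
  rw [(hS.localSpray x₀).jacobi_apply hz, h x₀ z hz, fderiv_locFun_sq hs hz]
  simp only [ContinuousLinearMap.comp_apply, _root_.smul_apply, _root_.sub_apply,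
    ContinuousLinearMap.smulRight_apply, tanJ_apply, dFun, liouville, smul_eq_mul]
  refine Prod.ext (by simp) ?_
  simp only [Prod.smul_snd, Prod.snd_sub]
  module

variable [FiniteDimensional ℝ E]

lemma HasFlagCurvature.ricciScalar_eq {κ : TangentBundle 𝓘(ℝ, E) M → ℝ}
    (hn : 2 ≤ Module.finrank ℝ E) (hF : IsFinsler F)
    (hκ : HasFlagCurvature F S κ) {x₀ : M} {z : E × E} (hz : z ∈ slitTarget E x₀) :
    ricciScalar (locVec S x₀) z = locFun κ x₀ z * locFun F x₀ z ^ 2 := by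
  refine ricciScalar_eq_of_jacobiCoeff hn (r := locFun κ x₀ z * locFun F x₀ z ^ 2)
    (B := (locFun κ x₀ z * (1 / 2)) • (fderiv ℝ (fun z => locFun F x₀ z ^ 2) z).comp
      (ContinuousLinearMap.inr ℝ E E)) (y := z.2) (fun a => ?_) ?_
  · rw [hκ.jacobiCoeff_eq (contDiffOn_locFun hF.smooth) hz]
    simp [mul_assoc]
  · have := (hF.localEnergy x₀).euler z hz
    simp [this]
    ring

end Finsler

/-! ### Coordinate form of isotropy. -/

section Isotropy

variable {E : Type*} [NormedAddCommGroup E] [NormedSpace ℝ E] [FiniteDimensional ℝ E]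
  {M : Type*} [TopologicalSpace M] [ChartedSpace E M] [IsManifold 𝓘(ℝ, E) ∞ M]
  {S : (p : TangentBundle 𝓘(ℝ, E) M) → TangentSpace (𝓘(ℝ, E).tangent) p}
  {α : (p : TangentBundle 𝓘(ℝ, E) M) → TangentSpace (𝓘(ℝ, E).tangent) p →L[ℝ] ℝ}

/-- The components of a semi-basic form. -/
def formCoeff (α : (p : TangentBundle 𝓘(ℝ, E) M) → TangentSpace (𝓘(ℝ, E).tangent) p →L[ℝ] ℝ)
    (x₀ : M) (z : E × E) : E →L[ℝ] ℝ :=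
  (locForm α x₀ z).comp (ContinuousLinearMap.inl ℝ E E)

omit [FiniteDimensional ℝ E] in
lemma IsSemibasic.locForm_apply (hα : IsSemibasic α) {x₀ : M} {z : E × E}
    (hz : z ∈ slitTarget E x₀) (u : E × E) : locForm α x₀ z u = formCoeff α x₀ z u.1 := by
  have h1 : u = (u.1, 0) + tanJ z (u.2, 0) := by simp [tanJ_apply]
  have h2 := congrArg (locForm α x₀ z) h1
  rw [map_add, hα.vertical x₀ z hz, add_zero] at h2
  rw [h2]
  rfl

-- A semi-basic form satisfies `i_J α = 0`, so only `i_J dα` survives in `d_J α`, and that involves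
-- vertical derivatives alone.
omit [FiniteDimensional ℝ E] in
lemma IsSemibasic.dForm_tanJ (hα : IsSemibasic α) {x₀ : M} {z : E × E}
    (hz : z ∈ slitTarget E x₀) (u w : E × E) :
    dForm tanJ (locForm α x₀) z u w = fderiv ℝ (formCoeff α x₀) z (0, u.1) w.1
      - fderiv ℝ (formCoeff α x₀) z (0, w.1) u.1 := by
  have ho := isOpen_slitTarget (E := E) x₀
  have hdA : DifferentiableAt ℝ (formCoeff α x₀) z :=
    differentiableAt_of_smoothOn ho ((hα.smooth x₀).clm_comp contDiffOn_const) hz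
  have h1 : ∀ v w : E × E, fderiv ℝ (locForm α x₀) z v w
      = fderiv ℝ (formCoeff α x₀) z v w.1 := by
    intro v w
    have e : fderiv ℝ (locForm α x₀) z
        = fderiv ℝ (fun z => (formCoeff α x₀ z).comp (ContinuousLinearMap.fst ℝ E E)) z :=
      fderiv_congr_of_isOpen ho
        (fun z hz => ContinuousLinearMap.ext fun u => hα.locForm_apply hz u) hz
    rw [e, fderiv_clm_comp hdA (differentiableAt_const _)]
    simp
  have h2 : fderiv ℝ (fun z' => (locForm α x₀ z').comp (tanJ z')) z = 0 := by
    have e := fderiv_congr_of_isOpen ho (f := fun z' => (locForm α x₀ z').comp (tanJ z'))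
      (g := fun _ => 0)
      (fun z hz => ContinuousLinearMap.ext fun u => hα.vertical x₀ z hz u) hz
    rw [e]; simp
  simp [dForm, extD, h1, h2, tanJ_apply]
  ring

omit [FiniteDimensional ℝ E] in
lemma IsIsotropicWith.jacobiCoeff_eq (hα : IsIsotropicWith S α)
    {x₀ : M} {z : E × E} (hz : z ∈ slitTarget E x₀) (a : E) :
    jacobiCoeff (locVec S x₀) z a
      = ricciScalar (locVec S x₀) z • a - formCoeff α x₀ z a • z.2 := by
  rw [jacobiCoeff, hα.2 x₀ z hz]
  simp [formCoeff, tanJ_apply, liouville]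

/-- The trace of `Φ = R J - α ⊗ ℂ` reads `(n - 1) R = n R - α(S)`. -/
lemma IsIsotropicWith.ricciScalar_eq (hn : 2 ≤ Module.finrank ℝ E) (hα : IsIsotropicWith S α)
    {x₀ : M} {z : E × E} (hz : z ∈ slitTarget E x₀) :
    ricciScalar (locVec S x₀) z = formCoeff α x₀ z z.2 := by
  have h1 := ricci_eq_of_jacobiCoeff (fun a => hα.jacobiCoeff_eq hz a)
  rw [ricci_eq_mul_ricciScalar hn] at h1
  linarith

lemma IsIsotropicWith.localIsotropic (hn : 2 ≤ Module.finrank ℝ E) (hα : IsIsotropicWith S α)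
    (hJ : IsDJClosed α) (x₀ : M) :
    LocalIsotropic (locVec S x₀) (slitTarget E x₀) (formCoeff α x₀) where
  smooth := (hα.1.smooth x₀).clm_comp contDiffOn_const
  ne_zero z hz := hz.2
  jacobi_eq z hz a := by rw [← hα.ricciScalar_eq hn hz]; exact hα.jacobiCoeff_eq hz a
  symm z hz a b := by
    have h1 := hJ x₀ z hz (a, 0) (b, 0)
    rw [hα.1.dForm_tanJ hz] at h1
    exact sub_eq_zero.1 h1

omit [FiniteDimensional ℝ E] in
/-- The Ricci scalar of an isotropic spray is the chart independent function `α(S)`. -/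
lemma IsIsotropicWith.locFun_eq (hS : IsSpray S) (hα : IsIsotropicWith S α)
    {x₀ : M} {z : E × E} (hz : z ∈ slitTarget E x₀) :
    locFun (fun p => α p (S p)) x₀ z = formCoeff α x₀ z z.2 := by
  rw [← locForm_locVec hz.1, hα.1.locForm_apply hz, (hS.localSpray x₀).fst_eq z hz]

end Isotropy

/-! ### The implications between the five conditions and property (P). -/

section Equivalence

variable {E : Type*} [NormedAddCommGroup E] [NormedSpace ℝ E] [FiniteDimensional ℝ E]
  {M : Type*} [TopologicalSpace M] [ChartedSpace E M] [IsManifold 𝓘(ℝ, E) ∞ M]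
  {S : (p : TangentBundle 𝓘(ℝ, E) M) → TangentSpace (𝓘(ℝ, E).tangent) p}

omit [FiniteDimensional ℝ E] in
lemma ricciScalar_ne_zero (hn : 2 ≤ Module.finrank ℝ E) (hRic : HasNonvanishingRicci S) {x₀ : M}
    {z : E × E} (hz : z ∈ slitTarget E x₀) : ricciScalar (locVec S x₀) z ≠ 0 := fun h =>
  hRic x₀ z hz (by rw [ricci_eq_mul_ricciScalar hn, h, mul_zero])

omit [FiniteDimensional ℝ E] in
lemma exists_mem_slitTarget (hn : 2 ≤ Module.finrank ℝ E) (x₀ : M) :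
    ∃ z : E × E, z ∈ slitTarget E x₀ := by
  have : Nontrivial E := Module.nontrivial_of_finrank_pos (R := ℝ) (by omega)
  obtain ⟨v, hv⟩ := exists_ne (0 : E)
  exact ⟨(extChartAt 𝓘(ℝ, E) x₀ x₀, v), mem_slitTarget.2 ⟨mem_extChartAt_target x₀, hv⟩⟩

omit [FiniteDimensional ℝ E] in
lemma MetrizableConstantFlag.metrizableScalarFlag (h : MetrizableConstantFlag S) :
    MetrizableScalarFlag S := by
  obtain ⟨F, hF, k, hk, hκ⟩ := h
  exact ⟨F, hF, fun _ => k, contMDiffOn_const, fun _ _ => hk, hκ⟩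

lemma MetrizableConstantFlag.metrizableEinstein (hn : 2 ≤ Module.finrank ℝ E)
    (h : MetrizableConstantFlag S) : MetrizableEinstein S := by
  obtain ⟨F, hF, k, hk, hκ⟩ := h
  exact ⟨F, hF, fun _ => k, contMDiff_const, fun x₀ z hz => hκ.ricciScalar_eq hn hF.1 hz⟩

lemma MetrizableConstantFlag.isRicciConstant (hn : 2 ≤ Module.finrank ℝ E) (hS : IsSpray S)
    (h : MetrizableConstantFlag S) : IsRicciConstant S := by
  obtain ⟨F, hF, k, hk, hκ⟩ := h
  intro x₀ z hz
  have hX := hS.localSpray x₀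
  have hL := hF.1.localEnergy x₀
  refine ContinuousLinearMap.ext fun u => ?_
  rw [dFun, ContinuousLinearMap.comp_apply, hX.horProj_apply hz,
    fderiv_congr_of_isOpen hX.isOpen (fun z hz => hκ.ricciScalar_eq hn hF.1 hz) hz]
  have h1 : fderiv ℝ (fun z => locFun (fun _ => k) x₀ z * locFun F x₀ z ^ 2) z
      = k • fderiv ℝ (fun z => locFun F x₀ z ^ 2) z := fderiv_const_mul (hL.diff hz) k
  rw [h1, _root_.smul_apply, hX.fderiv_energy_horLift hL (hF.eulerLagrange hS x₀) hz]
  simp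

lemma MetrizableConstantFlag.isIsotropicADJ (hn : 2 ≤ Module.finrank ℝ E) (hS : IsSpray S)
    (h : MetrizableConstantFlag S) : IsIsotropicADJ S := by
  obtain ⟨F, hF, k, hk, hκ⟩ := h
  have hR := fun (x₀ : M) (z : E × E) (hz : z ∈ slitTarget E x₀) => hκ.ricciScalar_eq hn hF.1 hz
  have hn' : (2 : ℝ) ≤ Module.finrank ℝ E := by exact_mod_cast hn
  -- The form is read off from `k F d_J F = (k/2) d_J F²`.
  refine ⟨fun x₀ z hz => ?_, fun p => (k / 2) • vertForm (fun p => F p ^ 2) p, ?_⟩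
  · have hL := hF.1.localEnergy x₀
    have hric : ∀ z ∈ slitTarget E x₀, ricci (locVec S x₀) z
        = (((Module.finrank ℝ E : ℝ) - 1) * k) * locFun F x₀ z ^ 2 := fun z hz => by
      rw [ricci_eq_mul_ricciScalar hn, hR x₀ z hz, mul_assoc]; rfl
    have hLr : LocalEnergy (ricci (locVec S x₀)) (slitTarget E x₀) := (hL.const_mul _).congr hric
    refine (hLr.vertNondegenerate_iff hz).2 ?_
    exact VertNondegenerate.const_mul hL (hF.1.vertNondegenerate x₀)
      (mul_ne_zero (by linarith) hk) hric z hz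
  · have hloc : ∀ x₀ : M, ∀ z ∈ slitTarget E x₀,
        locForm (fun p => (k / 2) • vertForm (fun p => F p ^ 2) p) x₀ z
          = (k / 2) • dFun tanJ (fun z => locFun F x₀ z ^ 2) z := fun x₀ z hz => by
      have h1 := locForm_vertForm (f := fun p => F p ^ 2) hz ((hF.1.localEnergy x₀).diff hz)
      exact congrArg (fun θ => (k / 2) • θ) h1
    have hsmooth : ∀ x₀ : M, ContDiffOn ℝ ∞
        (dFun tanJ (fun z => locFun F x₀ z ^ 2)) (slitTarget E x₀) := fun x₀ =>
      (smoothOn_fderiv (isOpen_slitTarget x₀) (hF.1.localEnergy x₀).smooth).clm_comp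
        contDiffOn_const
    have hsb : IsSemibasic (fun p => (k / 2) • vertForm (fun p => F p ^ 2) p) := by
      refine ⟨fun x₀ => ((hsmooth x₀).const_smul (k / 2)).congr fun z hz => hloc x₀ z hz,
        fun x₀ z hz u => ?_⟩
      rw [hloc x₀ z hz]
      have h0 : ((0 : E), (0 : E)) = 0 := rfl
      simp [dFun, tanJ_apply, h0]
    refine ⟨⟨hsb, fun x₀ z hz => ?_⟩, fun x₀ z hz u w => ?_⟩
    · refine ContinuousLinearMap.ext fun u => ?_
      rw [(hS.localSpray x₀).jacobi_apply hz, hκ.jacobiCoeff_eq (contDiffOn_locFun hF.1.smooth) hz,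
        hR x₀ z hz, hloc x₀ z hz]
      refine Prod.ext (by simp [tanJ_apply, liouville]) ?_
      have hk' : locFun (fun _ => k) x₀ z = k := rfl
      simp only [hk', tanJ_apply, liouville, dFun, _root_.sub_apply, _root_.smul_apply,
        ContinuousLinearMap.smulRight_apply, ContinuousLinearMap.comp_apply, Prod.snd_sub,
        Prod.smul_snd, smul_eq_mul]
      module
    · have hL := hF.1.localEnergy x₀
      rw [hsb.dForm_tanJ hz]
      have h1 : ∀ v a : E, fderiv ℝ (formCoeff
          (fun p => (k / 2) • vertForm (fun p => F p ^ 2) p) x₀) z (0, v) a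
          = k / 2 * fderiv ℝ (fderiv ℝ fun z => locFun F x₀ z ^ 2) z (0, v) (0, a) := by
        intro v a
        have h2 : ∀ z ∈ slitTarget E x₀, formCoeff
            (fun p => (k / 2) • vertForm (fun p => F p ^ 2) p) x₀ z
            = (k / 2) • (fderiv ℝ (fun z => locFun F x₀ z ^ 2) z).comp
              (ContinuousLinearMap.inr ℝ E E) := fun z hz => by
          rw [formCoeff, hloc x₀ z hz]; rfl
        have h3 := (((hL.diff_fderiv hz).hasFDerivAt.clm_comp (hasFDerivAt_const
          (ContinuousLinearMap.inr ℝ E E) z)).const_smul (k / 2)).fderiv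
        rw [fderiv_congr_of_isOpen hL.isOpen h2 hz]
        refine (congrArg (fun A => A (0, v) a) h3).trans ?_
        simp
      rw [h1, h1, hL.symm hz, sub_self]

variable [ConnectedSpace M]

/-- Any metrizing `F` already works: Schur's lemma applies to `α(S) / F²`, which is used in place of
`R / F²` because it is defined on `TM` independently of charts. -/
lemma metrizableConstantFlag_of_metrizable (hn : 3 ≤ Module.finrank ℝ E) (hS : IsSpray S)
    (hRic : HasNonvanishingRicci S)
    {α : (p : TangentBundle 𝓘(ℝ, E) M) → TangentSpace (𝓘(ℝ, E).tangent) p →L[ℝ] ℝ}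
    (hα : IsIsotropicWith S α) (hJ : IsDJClosed α) (h : Metrizable S) :
    MetrizableConstantFlag S := by
  have hn' : 2 ≤ Module.finrank ℝ E := by omega
  obtain ⟨F, hF⟩ := h
  set κ : TangentBundle 𝓘(ℝ, E) M → ℝ := fun p => α p (S p) / F p ^ 2 with hκ
  have hκloc : ∀ x₀ : M, ∀ z ∈ slitTarget E x₀,
      locFun κ x₀ z = formCoeff α x₀ z z.2 / locFun F x₀ z ^ 2 := fun x₀ z hz => by
    rw [← hα.locFun_eq hS hz]; rfl
  have hL0 : ∀ x₀ : M, ∀ z ∈ slitTarget E x₀, locFun F x₀ z ^ 2 ≠ 0 := fun x₀ z hz =>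
    (pow_pos (hF.1.locFun_pos hz) 2).ne'
  obtain ⟨k, hk⟩ := exists_const_of_fderiv_eq_zero hn' (f := κ) fun x₀ z hz =>
    ((hα.localIsotropic hn' hJ x₀).hasFDerivAt_flagCurvature (hS.localSpray x₀)
      (hF.1.localEnergy x₀) (hF.eulerLagrange hS x₀) (hL0 x₀) (hF.1.vertNondegenerate x₀) hn
      hz).congr_of_eventuallyEq
      (Filter.eventuallyEq_of_mem ((isOpen_slitTarget x₀).mem_nhds hz) (hκloc x₀))
  have hkloc : ∀ x₀ : M, ∀ z ∈ slitTarget E x₀,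
      formCoeff α x₀ z z.2 / locFun F x₀ z ^ 2 = k := fun x₀ z hz => by
    rw [← hκloc x₀ z hz]; exact hk _ (tchart_symm_mem_slit hz)
  refine ⟨F, hF, k, ?_, hasFlagCurvature_of_jacobiCoeff_eq hS (contDiffOn_locFun hF.1.smooth)
    fun x₀ z hz a => ?_⟩
  · rintro rfl
    obtain ⟨x₀⟩ := (inferInstance : Nonempty M)
    obtain ⟨z, hz⟩ := exists_mem_slitTarget hn' x₀
    have h1 := (div_eq_zero_iff.1 (hkloc x₀ z hz)).resolve_right (hL0 x₀ z hz)
    rw [← hα.ricciScalar_eq hn' hz] at h1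
    exact ricciScalar_ne_zero hn' hRic hz h1
  · have hI := hα.localIsotropic hn' hJ x₀
    rw [hI.jacobi_eq z hz, hI.form_eq_of_eulerLagrange (hS.localSpray x₀) (hF.1.localEnergy x₀)
      (hF.eulerLagrange hS x₀) (hL0 x₀) hz a, hkloc x₀ z hz]
    have h1 := (div_eq_iff (hL0 x₀ z hz)).1 (hkloc x₀ z hz)
    rw [h1]
    rfl

/-- The metric is `F = √|R|`, with `R` represented by the global function `r = α(S)`. -/
lemma metrizableConstantFlag_of_isRicciConstant (hn : 3 ≤ Module.finrank ℝ E) (hS : IsSpray S)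
    (hRic : HasNonvanishingRicci S) (hA : ConditionA S)
    {α : (p : TangentBundle 𝓘(ℝ, E) M) → TangentSpace (𝓘(ℝ, E).tangent) p →L[ℝ] ℝ}
    (hα : IsIsotropicWith S α) (hJ : IsDJClosed α) (h : IsRicciConstant S) :
    MetrizableConstantFlag S := by
  have hn' : 2 ≤ Module.finrank ℝ E := by omega
  have hn'' : (2 : ℝ) ≤ Module.finrank ℝ E := by exact_mod_cast hn'
  have hI := fun x₀ : M => hα.localIsotropic hn' hJ x₀
  set r : TangentBundle 𝓘(ℝ, E) M → ℝ := fun p => α p (S p) with hr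
  have hrA : ∀ x₀ : M, ∀ z ∈ slitTarget E x₀, locFun r x₀ z = formCoeff α x₀ z z.2 :=
    fun x₀ z hz => hα.locFun_eq hS hz
  have hrR : ∀ x₀ : M, ∀ z ∈ slitTarget E x₀, locFun r x₀ z = ricciScalar (locVec S x₀) z :=
    fun x₀ z hz => by rw [hrA x₀ z hz, hα.ricciScalar_eq hn' hz]
  have hr0 : ∀ x₀ : M, ∀ z ∈ slitTarget E x₀, locFun r x₀ z ≠ 0 := fun x₀ z hz => by
    rw [hrR x₀ z hz]; exact ricciScalar_ne_zero hn' hRic hz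
  have hrL : ∀ x₀ : M, LocalEnergy (locFun r x₀) (slitTarget E x₀) := fun x₀ => by
    refine LocalEnergy.congr (L := fun z => formCoeff α x₀ z z.2) ?_ (hrA x₀)
    exact ⟨isOpen_slitTarget x₀, (hI x₀).smooth.clm_apply contDiffOn_snd,
      fun z hz => (hI x₀).fderiv_scalar_liouville (hS.localSpray x₀) hn' hz⟩
  have hself : ∀ p ∈ slit E M, ∃ z ∈ slitTarget E p.1, (tchart E p.1).symm z = p := fun p hp =>
    ⟨tchart E p.1 p, tchart_mem_slitTarget (mem_chart_source E p.1) hp,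
      (tchart E p.1).left_inv (mem_tchart_source.2 (mem_chart_source E p.1))⟩
  have hr0' : ∀ p ∈ slit E M, r p ≠ 0 := fun p hp => by
    obtain ⟨z, hz, hzp⟩ := hself p hp
    have := hr0 _ z hz
    rwa [locFun, hzp] at this
  have hhom : ∀ p ∈ slit E M, ∀ c : ℝ, 0 < c → r ⟨p.1, c • p.2⟩ = c ^ 2 * r p := by
    intro p hp c hc
    obtain ⟨z, hz, hzp⟩ := hself p hp
    have h1 := pos_homogeneous_of_euler (U := slitTarget E p.1)
      (fun z hz t ht => smul_mem_slitTarget hz ht.ne') (fun z hz => (hrL p.1).diff hz)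
      (hrL p.1).euler hz hc
    rw [locFun, tchart_symm_smul hz.1, locFun, hzp] at h1
    exact h1
  -- The sign of `r` is locally constant, `r` being continuous and non-zero. The constant `k = ±1`
  -- lets the smooth function `k r` replace `|r|`.
  obtain ⟨k, hk⟩ := exists_const_of_fderiv_eq_zero hn' (f := fun p => r p / |r p|)
    fun x₀ z hz => by
      have hc := ((hrL x₀).diff hz).continuousAt
      rcases lt_or_gt_of_ne (hr0 x₀ z hz) with h1 | h1
      · refine (hasFDerivAt_const (-1 : ℝ) z).congr_of_eventuallyEq ?_
        filter_upwards [hc.eventually_lt_const h1] with z' hz'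
        change locFun r x₀ z' / |locFun r x₀ z'| = -1
        rw [abs_of_neg hz', div_neg, div_self hz'.ne]
      · refine (hasFDerivAt_const (1 : ℝ) z).congr_of_eventuallyEq ?_
        filter_upwards [hc.eventually_const_lt h1] with z' hz'
        change locFun r x₀ z' / |locFun r x₀ z'| = 1
        rw [abs_of_pos hz', div_self hz'.ne']
  have hkr : ∀ p ∈ slit E M, r p = k * |r p| := fun p hp =>
    (div_eq_iff (abs_ne_zero.2 (hr0' p hp))).1 (hk p hp)
  have hk2 : k * k = 1 := by
    obtain ⟨x₀⟩ := (inferInstance : Nonempty M)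
    obtain ⟨z, hz⟩ := exists_mem_slitTarget hn' x₀
    have hp := tchart_symm_mem_slit hz
    rw [← hk _ hp, div_mul_div_comm, abs_mul_abs_self, div_self]
    exact mul_self_ne_zero.2 (hr0' _ hp)
  have hk0 : k ≠ 0 := fun h0 => by simp [h0] at hk2
  have habs : ∀ p ∈ slit E M, |r p| = k * r p := fun p hp => by
    have h1 := hkr p hp
    calc |r p| = k * k * |r p| := by rw [hk2, one_mul]
      _ = k * r p := by rw [mul_assoc, ← h1]
  classical
  -- On the zero section `r` is arbitrary, so the value 0 is imposed there, as homogeneity demands.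
  set F : TangentBundle 𝓘(ℝ, E) M → ℝ := fun p => if p ∈ slit E M then √|r p| else 0 with hFdef
  have hFslit : ∀ p ∈ slit E M, F p = √|r p| := fun p hp => if_pos hp
  have hFloc : ∀ x₀ : M, ∀ z ∈ slitTarget E x₀, locFun F x₀ z = √(k * locFun r x₀ z) :=
    fun x₀ z hz => by
      have hp := tchart_symm_mem_slit hz
      rw [locFun, hFslit _ hp, habs _ hp, locFun]
  have hpos : ∀ x₀ : M, ∀ z ∈ slitTarget E x₀, 0 < k * locFun r x₀ z := fun x₀ z hz => by
    have hp := tchart_symm_mem_slit hz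
    rw [locFun, ← habs _ hp]
    exact abs_pos.2 (hr0' _ hp)
  have hFsq : ∀ x₀ : M, ∀ z ∈ slitTarget E x₀, locFun F x₀ z ^ 2 = k * locFun r x₀ z :=
    fun x₀ z hz => by rw [hFloc x₀ z hz, Real.sq_sqrt (hpos x₀ z hz).le]
  have hFs : ∀ x₀ : M, ContDiffOn ℝ ∞ (locFun F x₀) (slitTarget E x₀) := fun x₀ =>
    ((contDiffOn_const.mul (hrL x₀).smooth).sqrt fun z hz => (hpos x₀ z hz).ne').congr (hFloc x₀)
  have hFh : ∀ (p : TangentBundle 𝓘(ℝ, E) M) (c : ℝ), 0 ≤ c →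
      F ⟨p.1, c • p.2⟩ = c * F p := by
    intro p c hc
    by_cases hp : p ∈ slit E M
    · rcases hc.eq_or_lt with rfl | hc
      · rw [zero_mul]
        exact if_neg fun h0 => h0 (zero_smul ℝ p.2)
      · have hp' : (⟨p.1, c • p.2⟩ : TangentBundle 𝓘(ℝ, E) M) ∈ slit E M :=
          smul_ne_zero hc.ne' hp
        rw [hFslit _ hp', hFslit _ hp, hhom p hp c hc, abs_mul, abs_of_pos (pow_pos hc 2),
          Real.sqrt_mul (pow_pos hc 2).le, Real.sqrt_sq hc.le]
    · have h0 : p.2 = 0 := not_not.1 hp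
      have h1 : F p = 0 := if_neg hp
      rw [h1, mul_zero]
      refine if_neg fun h2 => h2 ?_
      change c • p.2 = 0
      rw [h0, smul_zero]
  have hL := fun x₀ : M => localEnergy_sq hFs hFh x₀
  have hFm := contMDiffOn_of_locFun hFs
  have hnd : ∀ x₀ : M, VertNondegenerate (fun z => locFun F x₀ z ^ 2) (slitTarget E x₀) := by
    intro x₀
    have hric : ∀ z ∈ slitTarget E x₀, ricci (locVec S x₀) z
        = ((Module.finrank ℝ E : ℝ) - 1) * locFun r x₀ z := fun z hz => by
      rw [ricci_eq_mul_ricciScalar hn', hrR x₀ z hz]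
    have hLr : LocalEnergy (ricci (locVec S x₀)) (slitTarget E x₀) :=
      ((hrL x₀).const_mul _).congr hric
    have hG : VertNondegenerate (ricci (locVec S x₀)) (slitTarget E x₀) := fun z hz =>
      (hLr.vertNondegenerate_iff hz).1 (hA x₀ z hz)
    have hne : (Module.finrank ℝ E : ℝ) - 1 ≠ 0 := by linarith
    -- Condition (A) concerns `Ric = (n - 1) r`, while `F² = k r`; the constant is their ratio.
    refine VertNondegenerate.const_mul hLr hG (c := k / ((Module.finrank ℝ E : ℝ) - 1))
      (div_ne_zero hk0 hne) fun z hz => ?_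
    rw [hFsq x₀ z hz, hric z hz, ← mul_assoc, div_mul_cancel₀ _ hne]
  have hEL : ∀ x₀ : M,
      EulerLagrange (locVec S x₀) (fun z => locFun F x₀ z ^ 2) (slitTarget E x₀) := by
    intro x₀
    refine (hS.localSpray x₀).eulerLagrange_of_horizontal (hL x₀) fun z hz a => ?_
    have h1 := DFunLike.congr_fun (h x₀ z hz) (a, 0)
    rw [dFun, ContinuousLinearMap.comp_apply, (hS.localSpray x₀).horProj_apply hz,
      ← fderiv_congr_of_isOpen (isOpen_slitTarget x₀) (hrR x₀) hz] at h1
    rw [fderiv_congr_of_isOpen (isOpen_slitTarget x₀) (hFsq x₀) hz,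
      fderiv_const_mul ((hrL x₀).diff hz), _root_.smul_apply, h1]
    simp
  have hFin : IsFinsler F :=
    { continuous := continuous_of_homogeneous hFm.continuousOn hFh
      smooth := hFm
      pos := fun p hp => by
        rw [hFslit p hp]; exact Real.sqrt_pos.2 (abs_pos.2 (hr0' p hp))
      homogeneous := hFh
      regular := fun x₀ z hz => (finrank_metricTensor_iff (hL x₀) hz).2 (hnd x₀ z hz) }
  refine ⟨F, ⟨hFin, fun x₀ z hz => ((hL x₀).eulerLagrange_iff (hS.localSpray x₀).fst_eq hz).2
    (hEL x₀ z hz)⟩, k, hk0, hasFlagCurvature_of_jacobiCoeff_eq hS hFs fun x₀ z hz a => ?_⟩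
  -- With `F² = k r` and `d_J r = 2α`, flag curvature `k` produces `k² (r J - α ⊗ ℂ)`, which is `Φ`
  -- because `k² = 1`.
  have h1 := (hI x₀).fderiv_scalar_vert (hS.localSpray x₀) hn' hz a
  rw [← fderiv_congr_of_isOpen (isOpen_slitTarget x₀) (hrA x₀) hz] at h1
  rw [(hI x₀).jacobi_eq z hz, fderiv_congr_of_isOpen (isOpen_slitTarget x₀) (hFsq x₀) hz,
    fderiv_const_mul ((hrL x₀).diff hz), _root_.smul_apply, h1, hFsq x₀ z hz, ← hrA x₀ z hz]
  change _ = (k * _) • a - (k * _) • z.2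
  rw [← mul_assoc, hk2, one_mul, smul_eq_mul]
  congr 2
  linear_combination (-(formCoeff α x₀ z a)) * hk2

end Equivalence

end SprayGeometry

end

theorem theorem4p2 {E : Type*} [NormedAddCommGroup E] [NormedSpace ℝ E] [FiniteDimensional ℝ E]
    {M : Type*} [TopologicalSpace M] [T2Space M] [SecondCountableTopology M] [ConnectedSpace M]
    [ChartedSpace E M] [IsManifold 𝓘(ℝ, E) ∞ M]
    (hn : 3 ≤ Module.finrank ℝ E)
    (S : (p : TangentBundle 𝓘(ℝ, E) M) → TangentSpace (𝓘(ℝ, E).tangent) p)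
    (hS : SprayGeometry.IsSpray S) (hRic : SprayGeometry.HasNonvanishingRicci S) :
    (SprayGeometry.IsIsotropicADJ S →
      List.TFAE [SprayGeometry.Metrizable S, SprayGeometry.MetrizableScalarFlag S,
        SprayGeometry.MetrizableEinstein S, SprayGeometry.MetrizableConstantFlag S,
        SprayGeometry.IsRicciConstant S]) ∧
    (List.TFAE [SprayGeometry.Metrizable S, SprayGeometry.MetrizableScalarFlag S,
        SprayGeometry.MetrizableEinstein S, SprayGeometry.MetrizableConstantFlag S,
        SprayGeometry.IsRicciConstant S] →
      (SprayGeometry.Metrizable S ∨ SprayGeometry.MetrizableScalarFlag S ∨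
        SprayGeometry.MetrizableEinstein S ∨ SprayGeometry.MetrizableConstantFlag S ∨
        SprayGeometry.IsRicciConstant S) →
      SprayGeometry.IsIsotropicADJ S) := by
  have hn' : 2 ≤ Module.finrank ℝ E := by omega
  constructor
  · rintro ⟨hA, α, hα, hJ⟩
    tfae_have 4 → 2 := SprayGeometry.MetrizableConstantFlag.metrizableScalarFlag
    tfae_have 2 → 1 := fun ⟨F, hF, _⟩ => ⟨F, hF⟩
    tfae_have 4 → 3 := SprayGeometry.MetrizableConstantFlag.metrizableEinstein hn'
    tfae_have 3 → 1 := fun ⟨F, hF, _⟩ => ⟨F, hF⟩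
    tfae_have 1 → 4 := SprayGeometry.metrizableConstantFlag_of_metrizable hn hS hRic hα hJ
    tfae_have 4 → 5 := SprayGeometry.MetrizableConstantFlag.isRicciConstant hn' hS
    tfae_have 5 → 4 :=
      SprayGeometry.metrizableConstantFlag_of_isRicciConstant hn hS hRic hA hα hJ
    tfae_finish
  · intro hT h
    have h4 : SprayGeometry.MetrizableConstantFlag S := by
      rcases h with h | h | h | h | h
      · exact (hT.out 0 3).1 h
      · exact (hT.out 1 3).1 h
      · exact (hT.out 2 3).1 h
      · exact h
      · exact (hT.out 4 3).1 h
    exact h4.isIsotropicADJ hn' hS
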